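/- **Setting.** Let $n\ge 1$, $d\ge 0$, and let $f_1,\dots,f_n:\mathbb R^d\to\mathbb R$ be differentiable, $L$-smooth, i.e. $f_i(y)\le f_i(x)+\langle\nabla f_i(x),y-x\rangle+\frac L2\|y-x\|^2$ with $L\ge 0$, and $\mu$-strongly convex, i.e. $f_i(y)\ge f_i(x)+\langle\nabla f_i(x),y-x\rangle+\frac\mu2\|y-x\|^2$ with $\mu>0$. Put $f=\frac1n\sum_i f_i$, let $x^*$ be a minimizer of $f$ and $f^*=f(x^*)$. *Randomness.* The data samples $\xi_i^{(t)}$ ($t\in\mathbb N$, $1\le i\le n$), with law $\mathcal D_i$, and the internal randomness $\zeta_i^{(t)}$ of the compression, with law $\nu$, are all jointly independent. The stochastic gradients $\nabla F_i(x,\xi)$ (measurable in $(x,\xi)$) satisfy, for all $x$, $\mathbb E_{\xi\sim\mathcal D_i}\nabla F_i(x,\xi)=\nabla f_i(x)$ and $\mathbb E_{\xi\sim\mathcal D_i}\|\nabla F_i(x,\xi)-\nabla f_i(x)\|^2\le\sigma_i^2$; put $\bar\sigma^2=\frac1n\sum_i\sigma_i^2$. The compression operator $\mathcal C(x)=\mathcal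 C(x,\zeta)$ (measurable) has parameter $\omega\in(0,1]$: $\mathbb E_{\zeta\sim\nu}\|\mathcal C(x,\zeta)-x\|^2\le(1-\omega)\|x\|^2$ for all $x$. *Mixing matrix.* $W\in[0,1]^{n\times n}$ is symmetric and doubly stochastic with eigenvalues ordered so that $1=|\lambda_1|\ge|\lambda_2|\ge\dots\ge|\lambda_n|$, and $|\lambda_2|<1$ ($\lambda_2:=0$ if $n=1$). Put $\delta=1-|\lambda_2|$, $\beta=\max_i(1-\lambda_i)$, $$\gamma^*=\frac{2\delta\omega}{64\delta+\delta^2+16\beta^2+8\delta\beta^2-16\delta\omega},\qquad p=\frac{\gamma^*\delta}8 .$$ *Algorithm (SPARQ-SGD).* Let $T\ge1$, let $\mathcal I\subseteq\mathbb N$ be a set of synchronization indices with $0\in\mathcal I$ and $\mathrm{gap}(\mathcal I)\le H$: any two consecutive elements of $\mathcal I\cap[0,T]$ differ by at most $H$, and the last of them is at least $T-H$. Let $\eta_t=\frac{8}{\mu(a+t)}$ with $a\ge\max\{\frac{32L}{\mu},\frac{5H}{p}\}$, and let $0\le c_t$ be a nondecreasing threshold sequence with $c_t\le c_0t^{1-\epsilon}$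 for all $t$, where $c_0\ge0$ is a constant and $\epsilon\in(0,1)$. All nodes start from one point with exact estimates, $x_i^{(0)}=\hat x_i^{(0)}=x^{(0)}$. For $t=0,1,\dots$, let $x_i^{(t+1/2)}=x_i^{(t)}-\eta_t\nabla F_i(x_i^{(t)},\xi_i^{(t)})$. If $t+1\notin\mathcal I$, then $x_i^{(t+1)}=x_i^{(t+1/2)}$ and $\hat x_i^{(t+1)}=\hat x_i^{(t)}$. If $t+1\in\mathcal I$, then $$\hat x_i^{(t+1)}=\hat x_i^{(t)}+q_i^{(t)},\qquad x_i^{(t+1)}=x_i^{(t+1/2)}+\gamma^*\sum_j (W-I)_{ji}\,\hat x_j^{(t+1)},$$ with $q_i^{(t)}=\mathcal C\big(x_i^{(t+1/2)}-\hat x_i^{(t)},\zeta_i^{(t)}\big)$ if $\|x_i^{(t+1/2)}-\hat x_i^{(t)}\|^2>c_t\eta_t^2$ and $q_i^{(t)}=0$ otherwise. *Bounded second moment.* $\mathbb E\|\nabla F_i(x_i^{(t)},\xi_i^{(t)})\|^2\le G^2$ for all $i$ and all $t<T$. **Theorem.** Let $\bar x^{(t)}=\frac1n\sum_ix_i^{(t)}$,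 $S_T=\sum_{t=0}^{T-1}(a+t)^2$, $x_{avg}=\frac1{S_T}\sum_{t=0}^{T-1}(a+t)^2\bar x^{(t)}$ and $a_0=\|\bar x^{(0)}-x^*\|^2=\|x^{(0)}-x^*\|^2$. Then $f(x_{avg})$ is integrable and $$\mathbb E f(x_{avg})-f^*\le\frac{\mu a^3}{8S_T}a_0+\frac{4T(T+2a)}{\mu S_T}\frac{\bar\sigma^2}{n}+512\cdot160\,\frac{(2L+\mu)G^2H^2T}{\mu^2p^2S_T}+\frac{6400}{2-\epsilon}\,\frac{c_0\,\omega(2L+\mu)T^{2-\epsilon}}{\mu^2pS_T}.$$ Moreover $S_T\ge T^3/3$, and for all $T\ge a^3$ $$\mathbb E f(x_{avg})-f^*\le 36\,\frac{\bar\sigma^2}{\mu nT}+250000\,\frac{(2L+\mu)G^2H^2}{\mu^2p^2T^2}+19200\,\frac{c_0\,\omega(2L+\mu)}{\mu^2pT^{1+\epsilon}} .$$ -/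

import Mathlib

open MeasureTheory ProbabilityTheory

namespace SPARQ

noncomputable section

/-- Parameter space of the model, with the Euclidean norm. -/
abbrev Vec (d : ℕ) : Type := EuclideanSpace ℝ (Fin d)

/-- `L`-smoothness of a differentiable function. -/
def IsLSmooth {d : ℕ} (L : ℝ) (f : Vec d → ℝ) : Prop :=
  0 ≤ L ∧ Differentiable ℝ f ∧
    ∀ x y : Vec d, f y ≤ f x + inner ℝ (gradient f x) (y - x) + L / 2 * ‖y - x‖ ^ 2

/-- `μ`-strong convexity of a differentiable function. -/
def IsStronglyConvex {d : ℕ} (μ : ℝ) (f : Vec d → ℝ) : Prop :=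
  Differentiable ℝ f ∧
    ∀ x y : Vec d, f x + inner ℝ (gradient f x) (y - x) + μ / 2 * ‖y - x‖ ^ 2 ≤ f y

/-- The operator `C`, whose internal randomness has law `ν`, is a compression operator with
parameter `ω`: `E_C ‖C(x) - x‖² ≤ (1 - ω) ‖x‖²` for all `x`. -/
def IsCompression {d : ℕ} {Z : Type*} [MeasurableSpace Z] (ω : ℝ) (ν : Measure Z)
    (C : Vec d → Z → Vec d) : Prop :=
  ∀ x : Vec d, ∫⁻ z, ‖C x z - x‖ₑ ^ 2 ∂ν ≤ ENNReal.ofReal ((1 - ω) * ‖x‖ ^ 2)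

/-- Symmetric doubly stochastic matrices. -/
structure IsDoublyStochasticSymm {n : ℕ} (W : Matrix (Fin n) (Fin n) ℝ) : Prop where
  mem_Icc : ∀ i j, W i j ∈ Set.Icc (0 : ℝ) 1
  symm : W.IsSymm
  row_sum : ∀ i, ∑ j, W i j = 1
  col_sum : ∀ j, ∑ i, W i j = 1

/-- The real eigenvalues, with multiplicity. -/
def eigs {n : ℕ} (W : Matrix (Fin n) (Fin n) ℝ) : Multiset ℝ := W.charpoly.roots

/-- `|λ₂(W)|`: the second entry (index `1`) of the list of the absolute values of the eigenvalues,
with multiplicity, in decreasing order. It is `0` if there is only one eigenvalue (one node). -/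
def absLambdaTwo {n : ℕ} (W : Matrix (Fin n) (Fin n) ℝ) : ℝ :=
  (((eigs W).map (fun l : ℝ => |l|)).sort (fun x y : ℝ => x ≥ y)).getD 1 0

/-- The spectral gap `δ = 1 - |λ₂(W)|`. -/
def specGap {n : ℕ} (W : Matrix (Fin n) (Fin n) ℝ) : ℝ := 1 - absLambdaTwo W

/-- `β = max_i (1 - λ_i(W))`. -/
def specBeta {n : ℕ} (W : Matrix (Fin n) (Fin n) ℝ) : ℝ :=
  sSup {b : ℝ | ∃ l ∈ eigs W, b = 1 - l}

/-- The consensus step size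
`γ* = 2δω / (64δ + δ² + 16β² + 8δβ² - 16δω)`. -/
def gammaStar {n : ℕ} (W : Matrix (Fin n) (Fin n) ℝ) (ω : ℝ) : ℝ :=
  2 * specGap W * ω /
    (64 * specGap W + specGap W ^ 2 + 16 * specBeta W ^ 2
      + 8 * specGap W * specBeta W ^ 2 - 16 * specGap W * ω)

/-- `p = γ* δ / 8`. -/
def pRate {n : ℕ} (W : Matrix (Fin n) (Fin n) ℝ) (ω : ℝ) : ℝ :=
  gammaStar W ω * specGap W / 8

/-- Any two consecutive synchronization indices up to the horizon `T` are at most `H` apart, where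
the horizon `T` itself is counted as the end of the last round. -/
def GapLE (I : Set ℕ) (T H : ℕ) : Prop :=
  ∀ s ∈ I, ∀ s' ∈ insert T I, s < s' → s' ≤ T → (∀ r ∈ I, ¬ (s < r ∧ r < s')) → s' ≤ s + H

/-- The average `x̄ = (1/n) ∑ᵢ xᵢ` over the nodes. -/
def nodeAvg {n d : ℕ} (X : Fin n → Vec d) : Vec d := (n : ℝ)⁻¹ • ∑ i, X i

/-- The global objective `f = (1/n) ∑ᵢ fᵢ`. -/
def globalObj {n d : ℕ} (f : Fin n → Vec d → ℝ) (x : Vec d) : ℝ := (n : ℝ)⁻¹ * ∑ i, f i x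

/-- The input of SPARQ-SGD: stochastic gradient oracles `∇Fᵢ(x, ξ)`, compression operator, mixing
matrix, consensus step size, learning rates, triggering thresholds, synchronization indices and
the common initial point of the nodes. -/
structure Input (n d : ℕ) (Ξ Z : Type*) where
  gradF : Fin n → Vec d → Ξ → Vec d
  C : Vec d → Z → Vec d
  W : Matrix (Fin n) (Fin n) ℝ
  γ : ℝ
  η : ℕ → ℝ
  c : ℕ → ℝ
  I : Set ℕ
  x0 : Vec d

/-- The parameters `xᵢ` of all nodes together with their publicly known estimates `x̂ᵢ`. -/
structure State (n d : ℕ) where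
  x : Fin n → Vec d
  xhat : Fin n → Vec d

variable {n d : ℕ} {Ξ Z Ω : Type*}

/-- The local stochastic gradient step `x_i^{(t+1/2)} = x_i^{(t)} - η_t ∇F_i(x_i^{(t)}, ξ_i^{(t)})`. -/
def half (A : Input n d Ξ Z) (t : ℕ) (X : Fin n → Vec d) (ξ : Fin n → Ξ) : Fin n → Vec d :=
  fun i => X i - A.η t • A.gradF i (X i) (ξ i)

open Classical in
/-- The message of node `i` in a synchronization round: the compressed difference to the estimate
if the difference exceeds the threshold, and `0` (no communication) otherwise. -/
def message (A : Input n d Ξ Z) (t : ℕ) (S : State n d) (ξ : Fin n → Ξ) (ζ : Fin n → Z) :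
    Fin n → Vec d :=
  fun i =>
    if A.c t * A.η t ^ 2 < ‖half A t S.x ξ i - S.xhat i‖ ^ 2 then
      A.C (half A t S.x ξ i - S.xhat i) (ζ i)
    else 0

/-- The estimates after a synchronization round. -/
def syncHat (A : Input n d Ξ Z) (t : ℕ) (S : State n d) (ξ : Fin n → Ξ) (ζ : Fin n → Z) :
    Fin n → Vec d :=
  fun i => S.xhat i + message A t S ξ ζ i

open Classical in
/-- One iteration `t ↦ t + 1` of SPARQ-SGD. If `t + 1` is a synchronization index, the estimates
are updated and `X^{(t+1)} = X^{(t+1/2)} + γ X̂^{(t+1)} (W - I)`; otherwise only the local step is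
made. -/
def step (A : Input n d Ξ Z) (t : ℕ) (S : State n d) (ξ : Fin n → Ξ) (ζ : Fin n → Z) :
    State n d :=
  if t + 1 ∈ A.I then
    { x := fun i => half A t S.x ξ i
        + A.γ • ∑ j, (A.W - (1 : Matrix (Fin n) (Fin n) ℝ)) j i • syncHat A t S ξ ζ j
      xhat := syncHat A t S ξ ζ }
  else
    { x := half A t S.x ξ
      xhat := S.xhat }

/-- The iterates, on a sample space carrying the data samples `ξ t i` and the internal
randomness `ζ t i` of the compression. All nodes start from `x0`, with exact estimates. -/
def run (A : Input n d Ξ Z) (ξ : ℕ → Fin n → Ω → Ξ) (ζ : ℕ → Fin n → Ω → Z) :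
    ℕ → Ω → State n d
  | 0, _ => { x := fun _ => A.x0, xhat := fun _ => A.x0 }
  | t + 1, θ => step A t (run A ξ ζ t θ) (fun i => ξ t i θ) (fun i => ζ t i θ)

/-- `S_T = ∑_{t<T} (a+t)²`. -/
def weightSum (a : ℝ) (T : ℕ) : ℝ := ∑ t ∈ Finset.range T, (a + t) ^ 2

/-- `x_avg = (1/S_T) ∑_{t<T} (a+t)² x̄^{(t)}`. -/
def xAvg (A : Input n d Ξ Z) (ξ : ℕ → Fin n → Ω → Ξ) (ζ : ℕ → Fin n → Ω → Z) (a : ℝ) (T : ℕ)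
    (θ : Ω) : Vec d :=
  (weightSum a T)⁻¹ • ∑ t ∈ Finset.range T, (a + t) ^ 2 • nodeAvg (run A ξ ζ t θ).x

/-- The samples `ξ t i` and the compression randomness `ζ t i`, over all times `t` and all nodes
`i`, are measurable and jointly independent, with `ξ t i` of law `D i` and `ζ t i` of law `ν`. -/
structure IsSampling [MeasurableSpace Ω] [MeasurableSpace Ξ] [MeasurableSpace Z]
    (P : Measure Ω) (D : Fin n → Measure Ξ) (ν : Measure Z)
    (ξ : ℕ → Fin n → Ω → Ξ) (ζ : ℕ → Fin n → Ω → Z) : Prop where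
  meas_data : ∀ t i, Measurable (ξ t i)
  meas_comp : ∀ t i, Measurable (ζ t i)
  law_data : ∀ t i, P.map (ξ t i) = D i
  law_comp : ∀ t i, P.map (ζ t i) = ν
  indep : iIndep
    (Sum.elim
      (fun q : ℕ × Fin n => MeasurableSpace.comap (ξ q.1 q.2) inferInstance)
      (fun q : ℕ × Fin n => MeasurableSpace.comap (ζ q.1 q.2) inferInstance)) P

end

end SPARQ

/-!
Convergence rate of SPARQ-SGD for strongly convex objectives.

Gossip preserves the mean of the parameters (`nodeAvg_gossip`), so the mean `x̄` makes a
stochastic gradient step in every iteration, except that the gradients are taken at the local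
parameters and not at `x̄`. Smoothness and strong convexity give, in expectation, the perturbed
contraction `‖x̄⁺ - x*‖² ≤ (1 - ημ/2) ‖x̄ - x*‖² - η (f(x̄) - f*) + η² σ̄²/n + η (2L + μ) R`,
where `R` is the mean squared distance of the local parameters to `x̄`
(`IsRun.integral_norm_nodeAvg_succ_le`). The noises of different nodes are orthogonal, which gives
the factor `1/n` in the variance. Summation with the weights `(a + t)²` telescopes, as `(a + t)² /
η_t = μ (a + t)³ / 8` (`weighted_sum_le`), and Jensen's inequality passes to the weighted average
of the iterates.

It remains to bound `R` by a multiple of `η²` (`IsRun.integral_dev_le`). The potential is the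
consensus error plus the squared distance of the parameters to their public estimates (`energy`).
One gossip step with step size `γ*` contracts it (`exists_gossip_contraction`): mixing contracts
deviations from the mean by the spectral gap, since the eigenvalue `1` of `W` is simple with
constant eigenvector (`mixing_bounds`), and the compressed messages contract the error of the
estimates by `1 - ω`, up to the triggering threshold (`IsRun.memLp_estimate_error`). Between
synchronizations the potential grows at most by the accumulated local steps, of second moment at
most `H² G² η²`. Since the learning rate changes in one round at most by a factor `1 + p/5`, the
resulting recursion keeps the potential of the order of `η²` (`IsRun.energy_le`).

Independence enters through σ-algebras: the state at time `t` is measurable with respect to all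
random variables but a given one of iteration `t`, hence independent of that one
(`IsSampling.indepFun_data`, `IsSampling.indepFun_comp`).
-/

/-! ### Spectral bounds for the mixing matrix -/

namespace SPARQ

/-- The spectral theorem for a symmetric matrix in coordinates: eigenvectors `u k` for the
eigenvalues `l k`, for which Parseval's identity holds. -/
lemma exists_eigenframe {n : ℕ} {W : Matrix (Fin n) (Fin n) ℝ} (hW : W.IsSymm) :
    ∃ (l : Fin n → ℝ) (u : Fin n → Fin n → ℝ),
      (∀ k i, ∑ j, W i j * u k j = l k * u k i) ∧
      (∀ v : Fin n → ℝ, ∑ k, (∑ i, u k i * v i) ^ 2 = ∑ i, v i ^ 2) ∧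
      eigs W = Finset.univ.val.map l := by
  have hH : W.IsHermitian := by
    rw [Matrix.IsHermitian, Matrix.conjTranspose_eq_transpose_of_trivial]; exact hW
  refine ⟨hH.eigenvalues, fun k i => hH.eigenvectorBasis k i, ?_, ?_, ?_⟩
  · intro k i
    have h := congrFun (hH.mulVec_eigenvectorBasis k) i
    simpa [Matrix.mulVec, dotProduct] using h
  · intro v
    have h := hH.eigenvectorBasis.sum_sq_norm_inner_right (WithLp.toLp 2 v)
    rw [EuclideanSpace.norm_sq_eq] at h
    simpa [EuclideanSpace.inner_eq_star_dotProduct, dotProduct, mul_comm] using h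
  · simpa [eigs] using hH.roots_charpoly_eq_eigenvalues

/-- All eigenvalues but one, counted with multiplicity, are at most `|λ₂|` in absolute value. -/
lemma exists_forall_abs_le_absLambdaTwo {n : ℕ} (hn : 0 < n) {W : Matrix (Fin n) (Fin n) ℝ}
    {l : Fin n → ℝ} (hl : eigs W = Finset.univ.val.map l) :
    0 ≤ absLambdaTwo W ∧ ∃ k₀, ∀ k ≠ k₀, |l k| ≤ absLambdaTwo W := by
  have hs := Multiset.sort_eq ((eigs W).map (fun l : ℝ => |l|)) (fun x y : ℝ => x ≥ y)
  have hp := Multiset.pairwise_sort ((eigs W).map (fun l : ℝ => |l|)) (fun x y : ℝ => x ≥ y)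
  unfold absLambdaTwo
  generalize ((eigs W).map (fun l : ℝ => |l|)).sort (fun x y : ℝ => x ≥ y) = s at hs hp
  rw [hl, Multiset.map_map] at hs
  rcases s with - | ⟨x, r⟩
  · have := congrArg Multiset.card hs
    simp at this
    omega
  have hx : x ∈ Finset.univ.val.map ((fun l : ℝ => |l|) ∘ l) := by rw [← hs]; simp
  obtain ⟨k₀, -, hk₀⟩ := Multiset.mem_map.1 hx
  have hr : (r : Multiset ℝ) = (Finset.univ.val.erase k₀).map ((fun l : ℝ => |l|) ∘ l) := by
    rw [← Multiset.cons_erase (Finset.mem_univ_val k₀), Multiset.map_cons, hk₀,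
      ← Multiset.cons_coe] at hs
    exact (Multiset.cons_inj_right x).1 hs
  have hb : ∀ y ∈ r, y ≤ r.getD 0 0 := by
    rcases r with - | ⟨b, r⟩
    · simp
    · intro y hy
      rcases List.mem_cons.1 hy with rfl | hy
      · simp
      · simpa using (List.pairwise_cons.1 (List.pairwise_cons.1 hp).2).1 y hy
  constructor
  · rcases r with - | ⟨b, r⟩
    · simp
    · have : b ∈ (Finset.univ.val.erase k₀).map ((fun l : ℝ => |l|) ∘ l) := by rw [← hr]; simp
      obtain ⟨k, -, hk⟩ := Multiset.mem_map.1 this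
      simp [← hk]
  · refine ⟨k₀, fun k hk => ?_⟩
    have : |l k| ∈ (r : Multiset ℝ) := by
      rw [hr]
      exact Multiset.mem_map.2 ⟨k, (Multiset.mem_erase_of_ne hk).2 (Finset.mem_univ k), rfl⟩
    simpa using hb _ (by simpa using this)

/-- For a symmetric doubly stochastic matrix with positive spectral gap, the eigenvalue `1` is
simple: the eigenvectors of all other eigenvalues are orthogonal to the constant vector, and the
eigenvector of `1` is a multiple of the constant vector. -/
lemma exists_consensus_eigenframe {n : ℕ} (hn : 0 < n) {W : Matrix (Fin n) (Fin n) ℝ}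
    (hW : IsDoublyStochasticSymm W) (hgap : absLambdaTwo W < 1) :
    ∃ (l : Fin n → ℝ) (u : Fin n → Fin n → ℝ) (k₀ : Fin n),
      (∀ k i, ∑ j, W i j * u k j = l k * u k i) ∧
      (∀ v : Fin n → ℝ, ∑ k, (∑ i, u k i * v i) ^ 2 = ∑ i, v i ^ 2) ∧
      (∀ k ≠ k₀, |l k| ≤ absLambdaTwo W) ∧ l k₀ = 1 ∧
      (∀ v : Fin n → ℝ, ∑ i, v i = 0 → ∑ i, u k₀ i * v i = 0) ∧
      0 ≤ absLambdaTwo W ∧ ∀ k, 1 - l k ≤ specBeta W := by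
  obtain ⟨l, u, hu, hP, hl⟩ := exists_eigenframe hW.symm
  obtain ⟨h0, k₀, hk₀⟩ := exists_forall_abs_le_absLambdaTwo hn hl
  -- the coefficient of the constant vector along `u k` is fixed by multiplication with `l k`
  have hfix : ∀ k, l k * ∑ i, u k i = ∑ i, u k i := by
    intro k
    rw [Finset.mul_sum]
    simp_rw [← hu]
    rw [Finset.sum_comm]
    simp_rw [← Finset.sum_mul, hW.col_sum, one_mul]
  have hzero : ∀ k ≠ k₀, ∑ i, u k i = 0 := by
    intro k hk
    have h1 : l k ≠ 1 := fun h => by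
      have := hk₀ k hk
      rw [h, abs_one] at this
      linarith
    have := hfix k
    have h2 : (l k - 1) * ∑ i, u k i = 0 := by linarith
    exact (mul_eq_zero.1 h2).resolve_left (sub_ne_zero.2 h1)
  have hsum : (∑ i, u k₀ i) ^ 2 = n := by
    have := hP (fun _ => 1)
    simp only [mul_one, one_pow, Finset.sum_const, Finset.card_univ, Fintype.card_fin,
      nsmul_eq_mul] at this
    rw [← this]
    exact (Finset.sum_eq_single (f := fun k => (∑ i, u k i) ^ 2) k₀
      (fun k _ hk => by simp [hzero k hk]) (by simp)).symm
  have hn' : (0 : ℝ) < n := by exact_mod_cast hn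
  have hne : ∑ i, u k₀ i ≠ 0 := fun h => by rw [h] at hsum; norm_num at hsum; linarith
  refine ⟨l, u, k₀, hu, hP, hk₀, mul_right_cancel₀ hne (by rw [hfix, one_mul]), ?_, h0, ?_⟩
  · intro v hv
    -- polarization of Parseval's identity for `v` and the constant vector
    have h1 := hP (fun i => v i + 1)
    have h2 := hP v
    have h3 : ∀ k, ∑ i, u k i * (v i + 1) = ∑ i, u k i * v i + ∑ i, u k i := fun k => by
      rw [← Finset.sum_add_distrib]; exact Finset.sum_congr rfl fun i _ => by ring
    have h4 : ∑ k, (∑ i, u k i * v i + ∑ i, u k i) ^ 2 = ∑ k, (∑ i, u k i * v i) ^ 2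
        + ∑ k, (2 * (∑ i, u k i * v i) * (∑ i, u k i) + (∑ i, u k i) ^ 2) := by
      rw [← Finset.sum_add_distrib]; exact Finset.sum_congr rfl fun i _ => by ring
    have h5 : ∑ k, (2 * (∑ i, u k i * v i) * (∑ i, u k i) + (∑ i, u k i) ^ 2)
        = 2 * (∑ i, u k₀ i * v i) * (∑ i, u k₀ i) + (∑ i, u k₀ i) ^ 2 :=
      Finset.sum_eq_single k₀ (fun k _ hk => by simp [hzero k hk]) (by simp)
    have h6 : ∑ i, (v i + 1) ^ 2 = ∑ i, v i ^ 2 + n := by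
      have : ∀ i, (v i + 1) ^ 2 = v i ^ 2 + 2 * v i + 1 := fun i => by ring
      simp_rw [this, Finset.sum_add_distrib, ← Finset.mul_sum, hv]
      simp
    simp_rw [h3] at h1
    rw [h4, h5, h6, h2, hsum] at h1
    have h7 : (∑ i, u k₀ i * v i) * (∑ i, u k₀ i) = 0 := by linarith
    exact (mul_eq_zero.1 h7).resolve_right hne
  · intro k
    apply le_csSup
    · have : {b : ℝ | ∃ x ∈ eigs W, b = 1 - x} ⊆ Set.range (fun k => 1 - l k) := by
        rintro b ⟨x, hx, rfl⟩
        rw [hl] at hx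
        obtain ⟨k, -, rfl⟩ := Multiset.mem_map.1 hx
        exact ⟨k, rfl⟩
      exact ((Set.finite_range _).subset this).bddAbove
    · exact ⟨l k, by rw [hl]; exact Multiset.mem_map.2 ⟨k, Finset.mem_univ k, rfl⟩, rfl⟩

/-- A polynomial `a + b W` of degree one in `W` acts on a vector with norm at most `r` if
`|a + b λ| ≤ r` for all eigenvalues `λ` with an eigenvector not orthogonal to the given vector. -/
lemma sum_sq_affine_le {n : ℕ} {W : Matrix (Fin n) (Fin n) ℝ}
    {l : Fin n → ℝ} {u : Fin n → Fin n → ℝ}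
    (hu : ∀ k i, ∑ j, W i j * u k j = l k * u k i)
    (hP : ∀ v : Fin n → ℝ, ∑ k, (∑ i, u k i * v i) ^ 2 = ∑ i, v i ^ 2)
    {a b r : ℝ} (v : Fin n → ℝ)
    (h : ∀ k, |a + b * l k| ≤ r ∨ ∑ i, u k i * v i = 0) :
    ∑ i, (a * v i + b * ∑ j, W j i * v j) ^ 2 ≤ r ^ 2 * ∑ i, v i ^ 2 := by
  rw [← hP v, ← hP (fun i => a * v i + b * ∑ j, W j i * v j), Finset.mul_sum]
  refine Finset.sum_le_sum fun k _ => ?_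
  have h1 : ∑ i, u k i * ∑ j, W j i * v j = l k * ∑ j, u k j * v j := by
    simp_rw [Finset.mul_sum]
    rw [Finset.sum_comm]
    refine Finset.sum_congr rfl fun j _ => ?_
    rw [← mul_assoc, ← hu k j, Finset.sum_mul]
    exact Finset.sum_congr rfl fun i _ => by ring
  have h2 : ∑ i, u k i * (a * v i + b * ∑ j, W j i * v j)
      = (a + b * l k) * ∑ i, u k i * v i := by
    rw [add_mul, mul_assoc, ← h1, Finset.mul_sum, Finset.mul_sum, ← Finset.sum_add_distrib]
    exact Finset.sum_congr rfl fun i _ => by ring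
  rw [h2, mul_pow]
  rcases h k with h | h
  · exact mul_le_mul_of_nonneg_right (sq_le_sq' (abs_le.1 h).1 (abs_le.1 h).2) (sq_nonneg _)
  · simp [h]

/-- Bounds on the action of `a + b W` on vectors over the nodes pass from the coordinates to the
whole parameters, as the squared Euclidean norm is the sum over the coordinates. -/
lemma sum_norm_sq_affine_le_of_coord {n d : ℕ} {W : Matrix (Fin n) (Fin n) ℝ} {a b r : ℝ}
    (V : Fin n → Vec d)
    (h : ∀ c, ∑ i, (a * V i c + b * ∑ j, W j i * V j c) ^ 2 ≤ r ^ 2 * ∑ i, V i c ^ 2) :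
    ∑ i, ‖a • V i + b • ∑ j, W j i • V j‖ ^ 2 ≤ r ^ 2 * ∑ i, ‖V i‖ ^ 2 := by
  simp_rw [EuclideanSpace.norm_sq_eq, Real.norm_eq_abs, sq_abs]
  rw [Finset.sum_comm, Finset.sum_comm (f := fun i c => (V i).ofLp c ^ 2), Finset.mul_sum]
  refine Finset.sum_le_sum fun c _ => ?_
  simpa using h c

/-- The three bounds on the mixing matrix used by consensus: a convex combination of `W` and the
identity contracts deviations from the mean, and `W - 1`, `1 - γ (W - 1)` have norms at most `β`
and `1 + γ β`. -/
lemma mixing_bounds {n d : ℕ} (hn : 0 < n) {W : Matrix (Fin n) (Fin n) ℝ}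
    (hW : IsDoublyStochasticSymm W) (hgap : absLambdaTwo W < 1) :
    0 < specGap W ∧ specGap W ≤ 1 ∧ 0 ≤ specBeta W ∧
    (∀ (γ : ℝ) (V : Fin n → Vec d), 0 ≤ γ → γ ≤ 1 → ∑ i, V i = 0 →
      ∑ i, ‖(1 - γ) • V i + γ • ∑ j, W j i • V j‖ ^ 2
        ≤ (1 - γ * specGap W) ^ 2 * ∑ i, ‖V i‖ ^ 2) ∧
    (∀ V : Fin n → Vec d,
      ∑ i, ‖(-1 : ℝ) • V i + (1 : ℝ) • ∑ j, W j i • V j‖ ^ 2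
        ≤ specBeta W ^ 2 * ∑ i, ‖V i‖ ^ 2) ∧
    (∀ (γ : ℝ) (V : Fin n → Vec d), 0 ≤ γ →
      ∑ i, ‖(1 + γ) • V i + (-γ) • ∑ j, W j i • V j‖ ^ 2
        ≤ (1 + γ * specBeta W) ^ 2 * ∑ i, ‖V i‖ ^ 2) := by
  obtain ⟨l, u, k₀, hu, hP, hk, hk₀, hv, h0, hβ⟩ := exists_consensus_eigenframe hn hW hgap
  have hle : ∀ k, l k ≤ 1 := fun k => by
    by_cases h : k = k₀
    · rw [h, hk₀]
    · linarith [le_abs_self (l k), hk k h]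
  refine ⟨by unfold specGap; linarith, by unfold specGap; linarith, ?_, ?_, ?_, ?_⟩
  · have := hβ k₀; linarith
  · intro γ V hγ hγ1 hV
    refine sum_norm_sq_affine_le_of_coord V fun c =>
      sum_sq_affine_le hu hP (fun i => V i c) fun k => ?_
    by_cases h : k = k₀
    · right
      rw [h]
      apply hv
      have := congrArg (fun w : Vec d => w c) hV
      simpa using this
    · left
      have := hk k h
      unfold specGap
      calc |1 - γ + γ * l k| ≤ |1 - γ| + |γ * l k| := abs_add_le _ _
        _ = (1 - γ) + γ * |l k| := by rw [abs_mul, abs_of_nonneg hγ, abs_of_nonneg (by linarith)]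
        _ ≤ _ := by nlinarith
  · intro V
    refine sum_norm_sq_affine_le_of_coord V fun c =>
      sum_sq_affine_le hu hP (fun i => V i c) fun k => Or.inl ?_
    rw [abs_le]; constructor <;> linarith [hβ k, hle k]
  · intro γ V hγ
    refine sum_norm_sq_affine_le_of_coord V fun c =>
      sum_sq_affine_le hu hP (fun i => V i c) fun k => Or.inl ?_
    have h1 := mul_le_mul_of_nonneg_left (hβ k) hγ
    have h2 := mul_nonneg hγ (sub_nonneg.2 (hle k))
    rw [abs_le]; constructor <;> linarith

end SPARQ

/-! ### Gossip steps -/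

namespace SPARQ

/-- The consensus error `∑ᵢ ‖xᵢ - x̄‖²`. -/
noncomputable def dev {n d : ℕ} (X : Fin n → Vec d) : ℝ := ∑ i, ‖X i - nodeAvg X‖ ^ 2

lemma dev_nonneg {n d : ℕ} (X : Fin n → Vec d) : 0 ≤ dev X :=
  Finset.sum_nonneg fun _ _ => sq_nonneg _

/-- Young's inequality for the square of a norm. -/
lemma norm_add_sq_le_young {E : Type*} [SeminormedAddCommGroup E] {s : ℝ} (hs : 0 < s) (a b : E) :
    ‖a + b‖ ^ 2 ≤ (1 + s) * ‖a‖ ^ 2 + (1 + 1 / s) * ‖b‖ ^ 2 := by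
  have h1 : ‖a + b‖ ^ 2 ≤ (‖a‖ + ‖b‖) ^ 2 :=
    pow_le_pow_left₀ (norm_nonneg _) (norm_add_le a b) 2
  have h2 : (1 + s) * ‖a‖ ^ 2 + (1 + 1 / s) * ‖b‖ ^ 2 - (‖a‖ + ‖b‖) ^ 2
      = (s * ‖a‖ - ‖b‖) ^ 2 / s := by field_simp; ring
  have h3 : 0 ≤ (s * ‖a‖ - ‖b‖) ^ 2 / s := by positivity
  linarith

lemma sum_norm_add_sq_le_young {E ι : Type*} [SeminormedAddCommGroup E] {s : ℝ} (hs : 0 < s)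
    (S : Finset ι) (a b : ι → E) :
    ∑ i ∈ S, ‖a i + b i‖ ^ 2 ≤ (1 + s) * ∑ i ∈ S, ‖a i‖ ^ 2 + (1 + 1 / s) * ∑ i ∈ S, ‖b i‖ ^ 2 := by
  rw [Finset.mul_sum, Finset.mul_sum, ← Finset.sum_add_distrib]
  exact Finset.sum_le_sum fun i _ => norm_add_sq_le_young hs _ _

lemma sum_eq_smul_nodeAvg {n d : ℕ} (hn : 0 < n) (X : Fin n → Vec d) :
    ∑ i, X i = (n : ℝ) • nodeAvg X := by
  rw [nodeAvg, smul_smul, mul_inv_cancel₀ (by positivity), one_smul]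

lemma sum_sub_nodeAvg {n d : ℕ} (hn : 0 < n) (X : Fin n → Vec d) :
    ∑ i, (X i - nodeAvg X) = 0 := by
  rw [Finset.sum_sub_distrib, sum_eq_smul_nodeAvg hn X]
  simp [Nat.cast_smul_eq_nsmul]

/-- The mean is the point with the least sum of squared distances. -/
lemma dev_le_sum_norm_sub_sq {n d : ℕ} (hn : 0 < n) (X : Fin n → Vec d) (c : Vec d) :
    dev X ≤ ∑ i, ‖X i - c‖ ^ 2 := by
  have h : ∀ i, ‖X i - c‖ ^ 2 = ‖X i - nodeAvg X‖ ^ 2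
      + 2 * inner ℝ (X i - nodeAvg X) (nodeAvg X - c) + ‖nodeAvg X - c‖ ^ 2 := fun i => by
    rw [← norm_add_sq_real]; congr 2; abel
  simp_rw [h, Finset.sum_add_distrib, ← Finset.mul_sum, ← sum_inner, sum_sub_nodeAvg hn,
    inner_zero_left]
  have : 0 ≤ ∑ _i : Fin n, ‖nodeAvg X - c‖ ^ 2 := Finset.sum_nonneg fun _ _ => sq_nonneg _
  unfold dev
  linarith

/-- Young's inequality for the consensus error; the perturbation `B` need not have mean zero. -/
lemma dev_young {n d : ℕ} (hn : 0 < n) {s : ℝ} (hs : 0 < s) (X B : Fin n → Vec d) :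
    dev (fun i => X i + B i) ≤ (1 + s) * dev X + (1 + 1 / s) * ∑ i, ‖B i‖ ^ 2 := by
  refine (dev_le_sum_norm_sub_sq hn _ (nodeAvg X)).trans ?_
  refine le_trans (le_of_eq ?_) (sum_norm_add_sq_le_young hs Finset.univ
    (fun i => X i - nodeAvg X) B)
  exact Finset.sum_congr rfl fun i _ => by congr 2; abel

lemma sum_mul_sub_one_smul {n d : ℕ} (W : Matrix (Fin n) (Fin n) ℝ) (Q : Fin n → Vec d)
    (i : Fin n) :
    ∑ j, (W - (1 : Matrix (Fin n) (Fin n) ℝ)) j i • Q j = ∑ j, W j i • Q j - Q i := by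
  simp_rw [Matrix.sub_apply, sub_smul, Finset.sum_sub_distrib]
  congr 1
  rw [Finset.sum_eq_single i]
  · simp
  · intro j _ hj; simp [hj]
  · simp

/-- A gossip step preserves the mean. -/
lemma nodeAvg_gossip {n d : ℕ} {W : Matrix (Fin n) (Fin n) ℝ} (hW : IsDoublyStochasticSymm W)
    (γ : ℝ) (Y Q : Fin n → Vec d) :
    nodeAvg (fun i => Y i + γ • ∑ j, (W - (1 : Matrix (Fin n) (Fin n) ℝ)) j i • Q j)
      = nodeAvg Y := by
  unfold nodeAvg
  simp_rw [sum_mul_sub_one_smul, Finset.sum_add_distrib, ← Finset.smul_sum,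
    Finset.sum_sub_distrib]
  rw [Finset.sum_comm]
  simp_rw [← Finset.sum_smul, hW.row_sum]
  simp

/-- The consensus error after a gossip step with inexact estimates `Q` of the parameters `Y`. -/
lemma dev_gossip_le {n d : ℕ} (hn : 0 < n) {W : Matrix (Fin n) (Fin n) ℝ}
    (hW : IsDoublyStochasticSymm W) (hgap : absLambdaTwo W < 1) {γ s : ℝ} (hγ : 0 ≤ γ)
    (hγ1 : γ ≤ 1) (hs : 0 < s) (Y Q : Fin n → Vec d) :
    dev (fun i => Y i + γ • ∑ j, (W - (1 : Matrix (Fin n) (Fin n) ℝ)) j i • Q j)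
      ≤ (1 + s) * (1 - γ * specGap W) ^ 2 * dev Y
        + (1 + 1 / s) * (γ ^ 2 * specBeta W ^ 2) * ∑ i, ‖Y i - Q i‖ ^ 2 := by
  obtain ⟨-, -, -, h1, h2, -⟩ := mixing_bounds (d := d) hn hW hgap
  have e1 := h1 γ (fun i => Y i - nodeAvg Y) hγ hγ1 (sum_sub_nodeAvg hn Y)
  have e2 := h2 (fun i => Q i - Y i)
  have key := sum_norm_add_sq_le_young hs Finset.univ
    (fun i => (1 - γ) • (Y i - nodeAvg Y) + γ • ∑ j, W j i • (Y j - nodeAvg Y))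
    (fun i => γ • ((-1 : ℝ) • (Q i - Y i) + (1 : ℝ) • ∑ j, W j i • (Q j - Y j)))
  have hsplit : ∀ i, (1 - γ) • (Y i - nodeAvg Y) + γ • ∑ j, W j i • (Y j - nodeAvg Y)
      + γ • ((-1 : ℝ) • (Q i - Y i) + (1 : ℝ) • ∑ j, W j i • (Q j - Y j))
      = Y i + γ • ∑ j, (W - (1 : Matrix (Fin n) (Fin n) ℝ)) j i • Q j - nodeAvg Y := by
    intro i
    simp_rw [sum_mul_sub_one_smul, smul_sub, Finset.sum_sub_distrib, ← Finset.sum_smul,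
      hW.col_sum]
    module
  simp_rw [hsplit, norm_smul, mul_pow, ← Finset.mul_sum, Real.norm_eq_abs, sq_abs] at key
  unfold dev
  rw [nodeAvg_gossip hW]
  have hs1 : 0 ≤ 1 / s := by positivity
  simp_rw [norm_sub_rev (Y _) (Q _)]
  calc _ ≤ _ := key
    _ ≤ (1 + s) * ((1 - γ * specGap W) ^ 2 * ∑ i, ‖Y i - nodeAvg Y‖ ^ 2)
        + (1 + 1 / s) * (γ ^ 2 * (specBeta W ^ 2 * ∑ i, ‖Q i - Y i‖ ^ 2)) := by gcongr
    _ = _ := by ring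

/-- The error of the estimates after a gossip step. -/
lemma sum_sub_estimate_gossip_le {n d : ℕ} (hn : 0 < n) {W : Matrix (Fin n) (Fin n) ℝ}
    (hW : IsDoublyStochasticSymm W) (hgap : absLambdaTwo W < 1) {γ s : ℝ} (hγ : 0 ≤ γ)
    (hs : 0 < s) (Y Q : Fin n → Vec d) :
    ∑ i, ‖Y i + γ • ∑ j, (W - (1 : Matrix (Fin n) (Fin n) ℝ)) j i • Q j - Q i‖ ^ 2
      ≤ (1 + s) * (1 + γ * specBeta W) ^ 2 * ∑ i, ‖Y i - Q i‖ ^ 2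
        + (1 + 1 / s) * (γ ^ 2 * specBeta W ^ 2) * dev Y := by
  obtain ⟨-, -, -, -, h2, h3⟩ := mixing_bounds (d := d) hn hW hgap
  have e1 := h3 γ (fun i => Y i - Q i) hγ
  have e2 := h2 (fun i => Y i - nodeAvg Y)
  have key := sum_norm_add_sq_le_young hs Finset.univ
    (fun i => (1 + γ) • (Y i - Q i) + (-γ) • ∑ j, W j i • (Y j - Q j))
    (fun i => γ • ((-1 : ℝ) • (Y i - nodeAvg Y) + (1 : ℝ) • ∑ j, W j i • (Y j - nodeAvg Y)))
  have hsplit : ∀ i, (1 + γ) • (Y i - Q i) + (-γ) • ∑ j, W j i • (Y j - Q j)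
      + γ • ((-1 : ℝ) • (Y i - nodeAvg Y) + (1 : ℝ) • ∑ j, W j i • (Y j - nodeAvg Y))
      = Y i + γ • ∑ j, (W - (1 : Matrix (Fin n) (Fin n) ℝ)) j i • Q j - Q i := by
    intro i
    simp_rw [sum_mul_sub_one_smul, smul_sub, Finset.sum_sub_distrib, ← Finset.sum_smul,
      hW.col_sum]
    module
  simp_rw [hsplit, norm_smul, mul_pow, ← Finset.mul_sum, Real.norm_eq_abs, sq_abs] at key
  unfold dev
  have hs1 : 0 ≤ 1 / s := by positivity
  calc _ ≤ _ := key
    _ ≤ (1 + s) * ((1 + γ * specBeta W) ^ 2 * ∑ i, ‖Y i - Q i‖ ^ 2)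
        + (1 + 1 / s) * (γ ^ 2 * (specBeta W ^ 2 * ∑ i, ‖Y i - nodeAvg Y‖ ^ 2)) := by gcongr
    _ = _ := by ring

/-- The consequences of the choice of the consensus step size `γ*` for the constants of the
gossip step, where Young's inequality is used with the parameters `γ δ / 2` and `ω / 4`. All of them
come from `γ (48 δ + 16 β²) ≤ 2 δ ω`. -/
lemma consensus_step_bounds {δ β ω γ : ℝ} (hδ : 0 < δ) (hδ1 : δ ≤ 1) (hβ : 0 ≤ β)
    (hω : 0 < ω) (hω1 : ω ≤ 1)
    (hγ : γ = 2 * δ * ω / (64 * δ + δ ^ 2 + 16 * β ^ 2 + 8 * δ * β ^ 2 - 16 * δ * ω)) :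
    0 < γ ∧ γ ≤ ω / 24 ∧
    (1 + γ * δ / 2) * (1 - γ * δ) ^ 2 + (1 + 1 / (ω / 4)) * (γ ^ 2 * β ^ 2)
      ≤ 1 - γ * δ / 2 ∧
    (1 + 1 / (γ * δ / 2)) * (γ ^ 2 * β ^ 2) + (1 + ω / 4) * (1 + γ * β) ^ 2
      ≤ 1 + 7 / 10 * ω := by
  have hD : 0 < 64 * δ + δ ^ 2 + 16 * β ^ 2 + 8 * δ * β ^ 2 - 16 * δ * ω := by
    have : δ * ω ≤ δ := by nlinarith
    have : 0 ≤ δ * β ^ 2 := by positivity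
    nlinarith [sq_nonneg δ, sq_nonneg β]
  have hγ0 : 0 < γ := by rw [hγ]; positivity
  have hmul : γ * (64 * δ + δ ^ 2 + 16 * β ^ 2 + 8 * δ * β ^ 2 - 16 * δ * ω) = 2 * δ * ω := by
    rw [hγ, div_mul_cancel₀ _ hD.ne']
  have hδω : γ * (δ * ω) ≤ γ * δ := by
    apply mul_le_mul_of_nonneg_left _ hγ0.le; nlinarith
  have p1 : 0 ≤ γ * δ ^ 2 := by positivity
  have p2 : 0 ≤ γ * β ^ 2 := by positivity
  have p3 : 0 ≤ γ * (δ * β ^ 2) := by positivity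
  have p4 : 0 < γ * δ := by positivity
  have hγω : γ ≤ ω / 24 := by
    have : δ * γ ≤ δ * (ω / 24) := by nlinarith
    exact le_of_mul_le_mul_left this hδ
  have hβ1 : γ * β ^ 2 ≤ δ * ω / 8 := by nlinarith
  have hx : γ * δ ≤ 1 / 24 := by nlinarith
  refine ⟨hγ0, hγω, ?_, ?_⟩
  · have h1 : (1 + 1 / (ω / 4)) * (γ ^ 2 * β ^ 2) ≤ 5 / 8 * (γ * δ) := by
      have : (1 + 1 / (ω / 4)) ≤ 5 / ω := by
        rw [le_div_iff₀ hω]; field_simp; linarith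
      calc (1 + 1 / (ω / 4)) * (γ ^ 2 * β ^ 2) ≤ 5 / ω * (γ * (δ * ω / 8)) := by
            rw [pow_two γ, mul_assoc γ]; gcongr
        _ = _ := by field_simp
    nlinarith [mul_nonneg p4.le p4.le, mul_nonneg (mul_nonneg p4.le p4.le) p4.le]
  · have h1 : (1 + 1 / (γ * δ / 2)) * (γ ^ 2 * β ^ 2) ≤ ω / 192 + ω / 4 := by
      have e : (1 + 1 / (γ * δ / 2)) * (γ ^ 2 * β ^ 2)
          = γ * (γ * β ^ 2) + 2 * (γ * β ^ 2) / δ := by field_simp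
      have e1 : 2 * (γ * β ^ 2) / δ ≤ ω / 4 := by
        rw [div_le_iff₀ hδ]; linarith
      have e2 : γ * (γ * β ^ 2) ≤ 1 / 24 * (ω / 8) := by
        gcongr
        · linarith
        · nlinarith
      rw [e]; linarith
    have h2 : γ * β ≤ 3 / 40 * ω := by
      -- `(γβ)² ≤ γ · δω/8 ≤ ω²/192`
      have : (γ * β) ^ 2 ≤ (3 / 40 * ω) ^ 2 := by
        have e3 : γ * (γ * β ^ 2) ≤ ω / 24 * (ω / 8) := by
          gcongr
          nlinarith
        nlinarith
      exact le_of_sq_le_sq this (by positivity)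
    have h3 : 0 ≤ γ * β := by positivity
    have h4 : (1 + γ * β) ^ 2 ≤ (1 + 3 / 40 * ω) ^ 2 := by gcongr
    have h5 : (1 + ω / 4) * (1 + γ * β) ^ 2 ≤ (1 + ω / 4) * (1 + 3 / 40 * ω) ^ 2 := by gcongr
    nlinarith [mul_nonneg hω.le hω.le]

lemma pRate_pos {n : ℕ} (hn : 0 < n) {W : Matrix (Fin n) (Fin n) ℝ}
    (hW : IsDoublyStochasticSymm W) (hgap : absLambdaTwo W < 1) {ω : ℝ} (hω : 0 < ω)
    (hω1 : ω ≤ 1) : 0 < pRate W ω ∧ pRate W ω ≤ 1 / 192 := by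
  obtain ⟨h1, h2, h3, -⟩ := mixing_bounds (d := 0) hn hW hgap
  obtain ⟨h4, h5, -⟩ := consensus_step_bounds h1 h2 h3 hω hω1 rfl
  change 0 < gammaStar W ω at h4
  change gammaStar W ω ≤ ω / 24 at h5
  unfold pRate
  refine ⟨by positivity, ?_⟩
  nlinarith

/-- One gossip step with step size `γ*` contracts the sum of the consensus error and of the error
of the estimates, if the messages reduce the error of the estimates by the factor `1 - ω`. -/
lemma exists_gossip_contraction {n : ℕ} (hn : 0 < n) {W : Matrix (Fin n) (Fin n) ℝ}
    (hW : IsDoublyStochasticSymm W) (hgap : absLambdaTwo W < 1) {ω : ℝ} (hω : 0 < ω)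
    (hω1 : ω ≤ 1) (d : ℕ) :
    ∃ κ : ℝ, 0 ≤ κ ∧ κ ≤ 2 ∧ κ * (1 - ω) ≤ 1 - 4 * pRate W ω ∧
      ∀ Y Q : Fin n → Vec d,
        dev (fun i => Y i + gammaStar W ω •
            ∑ j, (W - (1 : Matrix (Fin n) (Fin n) ℝ)) j i • Q j)
          + ∑ i, ‖Y i + gammaStar W ω •
            ∑ j, (W - (1 : Matrix (Fin n) (Fin n) ℝ)) j i • Q j - Q i‖ ^ 2
        ≤ (1 - 4 * pRate W ω) * dev Y + κ * ∑ i, ‖Y i - Q i‖ ^ 2 := by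
  obtain ⟨h1, h2, h3, -⟩ := mixing_bounds (d := 0) hn hW hgap
  obtain ⟨g0, g1, g2, g3⟩ := consensus_step_bounds h1 h2 h3 hω hω1 (γ := gammaStar W ω) rfl
  have hp : pRate W ω = gammaStar W ω * specGap W / 8 := rfl
  refine ⟨1 + 7 / 10 * ω, by linarith, by linarith, ?_, fun Y Q => ?_⟩
  · rw [hp]
    nlinarith
  · have e1 := dev_gossip_le hn hW hgap g0.le (by linarith)
      (s := gammaStar W ω * specGap W / 2) (by positivity) Y Q
    have e2 := sum_sub_estimate_gossip_le hn hW hgap g0.le (s := ω / 4) (by positivity) Y Q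
    have e3 := mul_le_mul_of_nonneg_right g2 (dev_nonneg Y)
    have e4 : 0 ≤ ∑ i, ‖Y i - Q i‖ ^ 2 := Finset.sum_nonneg fun _ _ => sq_nonneg _
    have e5 := mul_le_mul_of_nonneg_right g3 e4
    rw [hp]
    linarith

end SPARQ

/-! ### Smooth and strongly convex objectives, and the weighted summation -/

namespace SPARQ

/-- A quadratic decrease `s A - L s² A / 2` available at all step sizes `s` and bounded by `D`
bounds `A`; the best step size is `1 / L`. -/
lemma le_of_forall_descent {L A D : ℝ} (hL : 0 ≤ L) (hA : 0 ≤ A)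
    (h : ∀ s : ℝ, s * A - L / 2 * s ^ 2 * A ≤ D) : A ≤ 2 * L * D := by
  rcases hL.eq_or_lt with rfl | hL
  · rcases hA.eq_or_lt with rfl | hA
    · simp
    · have := h ((D + 1) / A)
      rw [div_mul_cancel₀ _ hA.ne'] at this
      simp at this
      linarith
  · have h1 := h (1 / L)
    have h2 : 1 / L * A - L / 2 * (1 / L) ^ 2 * A = A / (2 * L) := by field_simp; ring
    rw [h2, div_le_iff₀ (by positivity)] at h1
    linarith

lemma IsStronglyConvex.inner_le {d : ℕ} {μ : ℝ} (hμ : 0 ≤ μ) {f : Vec d → ℝ}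
    (h : IsStronglyConvex μ f) (x y : Vec d) :
    f x + inner ℝ (gradient f x) (y - x) ≤ f y := by
  have := h.2 x y
  have : 0 ≤ μ / 2 * ‖y - x‖ ^ 2 := by positivity
  linarith

/-- The gradient of a convex `L`-smooth function is `L`-Lipschitz. -/
lemma norm_gradient_sub_sq_le {d : ℕ} {L μ : ℝ} (hμ : 0 ≤ μ) {f : Vec d → ℝ}
    (hs : IsLSmooth L f) (hc : IsStronglyConvex μ f) (x y : Vec d) :
    ‖gradient f y - gradient f x‖ ^ 2 ≤ L ^ 2 * ‖y - x‖ ^ 2 := by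
  have key : ‖gradient f y - gradient f x‖ ^ 2
      ≤ 2 * L * (f y - f x - inner ℝ (gradient f x) (y - x)) := by
    refine le_of_forall_descent hs.1 (sq_nonneg _) fun s => ?_
    -- compare the lower bound at `x` and the upper bound at `y` in the point `z`
    set g := gradient f y - gradient f x with hg
    have h1 := hc.inner_le hμ x (y - s • g)
    have h2 := hs.2.2 y (y - s • g)
    have e1 : y - s • g - y = -(s • g) := by abel
    have e2 : y - s • g - x = (y - x) - s • g := by abel
    have e3 : inner ℝ (gradient f y) g - inner ℝ (gradient f x) g = ‖g‖ ^ 2 := by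
      rw [← inner_sub_left, ← hg, real_inner_self_eq_norm_sq]
    rw [e2, inner_sub_right, inner_smul_right] at h1
    rw [e1, inner_neg_right, inner_smul_right, norm_neg, norm_smul, mul_pow, Real.norm_eq_abs,
      sq_abs] at h2
    rw [← e3] at h2 ⊢
    linarith
  have h := hs.2.2 x y
  have := mul_le_mul_of_nonneg_left (sub_nonneg.2 h) (mul_nonneg zero_le_two hs.1)
  nlinarith

lemma norm_nodeAvg_sq_le {n d : ℕ} (hn : 0 < n) (V : Fin n → Vec d) :
    ‖nodeAvg V‖ ^ 2 ≤ (n : ℝ)⁻¹ * ∑ i, ‖V i‖ ^ 2 := by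
  have hn' : (0 : ℝ) < n := by exact_mod_cast hn
  have h1 : ‖∑ i, V i‖ ^ 2 ≤ n * ∑ i, ‖V i‖ ^ 2 :=
    (pow_le_pow_left₀ (norm_nonneg _) (norm_sum_le _ _) 2).trans
      (by simpa using sq_sum_le_card_mul_sum_sq (s := Finset.univ) (f := fun i => ‖V i‖))
  rw [nodeAvg, norm_smul, mul_pow, Real.norm_eq_abs, sq_abs]
  calc _ ≤ (n : ℝ)⁻¹ ^ 2 * (n * ∑ i, ‖V i‖ ^ 2) := by gcongr
    _ = _ := by field_simp

lemma inner_nodeAvg {n d : ℕ} (x : Vec d) (V : Fin n → Vec d) :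
    inner ℝ x (nodeAvg V) = (n : ℝ)⁻¹ * ∑ i, inner ℝ x (V i) := by
  rw [nodeAvg, inner_smul_right, inner_sum]

lemma globalObj_smooth {n d : ℕ} (hn : 0 < n) {L : ℝ} {f : Fin n → Vec d → ℝ}
    (hs : ∀ i, IsLSmooth L (f i)) (x y : Vec d) :
    globalObj f y ≤ globalObj f x + inner ℝ (nodeAvg fun i => gradient (f i) x) (y - x)
      + L / 2 * ‖y - x‖ ^ 2 := by
  have hn' : (0 : ℝ) < n := by exact_mod_cast hn
  have h : ∑ i, f i y ≤ ∑ i, (f i x + inner ℝ (y - x) (gradient (f i) x) + L / 2 * ‖y - x‖ ^ 2) :=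
    Finset.sum_le_sum fun i _ => by
      rw [real_inner_comm]; exact (hs i).2.2 x y
  simp_rw [Finset.sum_add_distrib] at h
  rw [real_inner_comm, inner_nodeAvg]
  unfold globalObj
  calc _ ≤ _ := mul_le_mul_of_nonneg_left h (inv_nonneg.2 hn'.le)
    _ = _ := by simp; field_simp

lemma globalObj_stronglyConvex {n d : ℕ} (hn : 0 < n) {μ : ℝ} {f : Fin n → Vec d → ℝ}
    (hc : ∀ i, IsStronglyConvex μ (f i)) (x y : Vec d) :
    globalObj f x + inner ℝ (nodeAvg fun i => gradient (f i) x) (y - x)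
      + μ / 2 * ‖y - x‖ ^ 2 ≤ globalObj f y := by
  have hn' : (0 : ℝ) < n := by exact_mod_cast hn
  have h : ∑ i, (f i x + inner ℝ (y - x) (gradient (f i) x) + μ / 2 * ‖y - x‖ ^ 2) ≤ ∑ i, f i y :=
    Finset.sum_le_sum fun i _ => by
      rw [real_inner_comm]; exact (hc i).2 x y
  simp_rw [Finset.sum_add_distrib] at h
  rw [real_inner_comm, inner_nodeAvg]
  unfold globalObj
  refine le_trans (le_of_eq ?_) (mul_le_mul_of_nonneg_left h (inv_nonneg.2 hn'.le))
  simp; field_simp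

/-- The gradient of the objective is controlled by the suboptimality. -/
lemma norm_nodeAvg_gradient_sq_le {n d : ℕ} (hn : 0 < n) {L : ℝ} (hL : 0 ≤ L)
    {f : Fin n → Vec d → ℝ} (hs : ∀ i, IsLSmooth L (f i)) {xstar : Vec d}
    (hx : ∀ x, globalObj f xstar ≤ globalObj f x) (x : Vec d) :
    ‖nodeAvg fun i => gradient (f i) x‖ ^ 2 ≤ 2 * L * (globalObj f x - globalObj f xstar) := by
  refine le_of_forall_descent hL (sq_nonneg _) fun s => ?_
  set g := nodeAvg fun i => gradient (f i) x with hg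
  have h1 := hx (x - s • g)
  have h2 := globalObj_smooth hn hs x (x - s • g)
  have e1 : x - s • g - x = -(s • g) := by abel
  rw [e1, ← hg, inner_neg_right, inner_smul_right, norm_neg, norm_smul, mul_pow, Real.norm_eq_abs,
    sq_abs, real_inner_self_eq_norm_sq] at h2
  linarith

/-- One exact gradient step of the mean, with the gradients taken at the local parameters. -/
lemma norm_sub_nodeAvg_gradient_sq_le {n d : ℕ} (hn : 0 < n) {L μ η : ℝ} (hμ : 0 < μ)
    {f : Fin n → Vec d → ℝ} (hs : ∀ i, IsLSmooth L (f i)) (hc : ∀ i, IsStronglyConvex μ (f i))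
    {xstar : Vec d} (hx : ∀ x, globalObj f xstar ≤ globalObj f x) (hη : 0 ≤ η)
    (hηL : η * L ≤ 1 / 4) (X : Fin n → Vec d) :
    ‖nodeAvg X - xstar - η • nodeAvg fun i => gradient (f i) (X i)‖ ^ 2
      ≤ (1 - η * μ / 2) * ‖nodeAvg X - xstar‖ ^ 2
        - η * (globalObj f (nodeAvg X) - globalObj f xstar)
        + η * (2 * L + μ) * ((n : ℝ)⁻¹ * dev X) := by
  have hn' : (0 : ℝ) < n := by exact_mod_cast hn
  have hL : 0 ≤ L := (hs ⟨0, hn⟩).1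
  set xb := nodeAvg X with hxb
  have hR : 0 ≤ (n : ℝ)⁻¹ * dev X := mul_nonneg (inv_nonneg.2 hn'.le) (dev_nonneg X)
  have he : 0 ≤ globalObj f xb - globalObj f xstar := sub_nonneg.2 (hx _)
  -- the inner product with the descent direction
  have hin : globalObj f xb - globalObj f xstar + μ / 4 * ‖xb - xstar‖ ^ 2
      - (L / 2 + μ / 2) * ((n : ℝ)⁻¹ * dev X)
      ≤ inner ℝ (xb - xstar) (nodeAvg fun i => gradient (f i) (X i)) := by
    rw [inner_nodeAvg]
    have h : ∀ i, f i xb - f i xstar + μ / 4 * ‖xb - xstar‖ ^ 2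
        - (L / 2 + μ / 2) * ‖X i - xb‖ ^ 2 ≤ inner ℝ (xb - xstar) (gradient (f i) (X i)) := by
      intro i
      have h1 := (hs i).2.2 (X i) xb
      have h2 := (hc i).2 (X i) xstar
      have h3 := norm_add_sq_le_young one_pos (xb - X i) (X i - xstar)
      have e1 : xb - X i + (X i - xstar) = xb - xstar := by abel
      have e2 : xb - xstar = (xb - X i) - (xstar - X i) := by abel
      rw [e1] at h3
      rw [real_inner_comm, e2, inner_sub_right, ← e2, norm_sub_rev (X i) xb]
      rw [norm_sub_rev xstar (X i)] at h2
      nlinarith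
    have h' := Finset.sum_le_sum fun i (_ : i ∈ Finset.univ) => h i
    refine le_trans (le_of_eq ?_) (mul_le_mul_of_nonneg_left h' (inv_nonneg.2 hn'.le))
    simp_rw [Finset.sum_sub_distrib, Finset.sum_add_distrib, Finset.sum_sub_distrib,
      ← Finset.mul_sum]
    unfold globalObj dev
    rw [← hxb]
    simp
    field_simp
  -- the squared length of the descent direction
  have hsq : ‖nodeAvg fun i => gradient (f i) (X i)‖ ^ 2
      ≤ 2 * (L ^ 2 * ((n : ℝ)⁻¹ * dev X)) + 4 * L * (globalObj f xb - globalObj f xstar) := by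
    have e : (nodeAvg fun i => gradient (f i) (X i))
        = (nodeAvg fun i => gradient (f i) (X i) - gradient (f i) xb)
          + nodeAvg fun i => gradient (f i) xb := by
      unfold nodeAvg; rw [← smul_add, ← Finset.sum_add_distrib]; simp
    have h1 := norm_add_sq_le_young one_pos
      (nodeAvg fun i => gradient (f i) (X i) - gradient (f i) xb)
      (nodeAvg fun i => gradient (f i) xb)
    have h2 := norm_nodeAvg_sq_le hn fun i => gradient (f i) (X i) - gradient (f i) xb
    have h3 := norm_nodeAvg_gradient_sq_le hn hL hs hx xb
    have h4 : (n : ℝ)⁻¹ * ∑ i, ‖gradient (f i) (X i) - gradient (f i) xb‖ ^ 2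
        ≤ (n : ℝ)⁻¹ * (L ^ 2 * dev X) := by
      unfold dev
      rw [Finset.mul_sum Finset.univ _ (L ^ 2)]
      exact mul_le_mul_of_nonneg_left (Finset.sum_le_sum fun i _ =>
        norm_gradient_sub_sq_le hμ.le (hs i) (hc i) xb (X i)) (inv_nonneg.2 hn'.le)
    rw [e]
    linarith
  rw [norm_sub_sq_real, inner_smul_right, norm_smul, mul_pow, Real.norm_eq_abs, sq_abs]
  have h1 := mul_le_mul_of_nonneg_left hin hη
  have h2 := mul_le_mul_of_nonneg_left hsq (sq_nonneg η)
  have h3 : η ^ 2 * (4 * L * (globalObj f xb - globalObj f xstar))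
      ≤ η * (globalObj f xb - globalObj f xstar) := by
    have := mul_le_mul_of_nonneg_right hηL (mul_nonneg hη he)
    linarith
  have h4 : η ^ 2 * (2 * (L ^ 2 * ((n : ℝ)⁻¹ * dev X)))
      ≤ η * L * ((n : ℝ)⁻¹ * dev X) := by
    have := mul_le_mul_of_nonneg_right hηL (mul_nonneg (mul_nonneg hη hL) hR)
    have h5 : 0 ≤ η * L * ((n : ℝ)⁻¹ * dev X) := mul_nonneg (mul_nonneg hη hL) hR
    linarith
  linarith

/-- Jensen's inequality for the weighted average of points. -/
lemma globalObj_weighted_le {n d : ℕ} (hn : 0 < n) {μ : ℝ} (hμ : 0 ≤ μ) {f : Fin n → Vec d → ℝ}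
    (hc : ∀ i, IsStronglyConvex μ (f i)) {T : ℕ} {w : ℕ → ℝ} (hw : ∀ t, 0 ≤ w t)
    (hS : 0 < ∑ t ∈ Finset.range T, w t) (x : ℕ → Vec d) :
    globalObj f ((∑ t ∈ Finset.range T, w t)⁻¹ • ∑ t ∈ Finset.range T, w t • x t)
      ≤ (∑ t ∈ Finset.range T, w t)⁻¹ * ∑ t ∈ Finset.range T, w t * globalObj f (x t) := by
  set S := ∑ t ∈ Finset.range T, w t with hSdef
  set y := S⁻¹ • ∑ t ∈ Finset.range T, w t • x t with hy
  rw [inv_mul_eq_div, le_div_iff₀ hS]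
  have h : ∀ t ∈ Finset.range T, w t * (globalObj f y
      + inner ℝ (nodeAvg fun i => gradient (f i) y) (x t - y)) ≤ w t * globalObj f (x t) :=
    fun t _ => mul_le_mul_of_nonneg_left (by
      have h1 := globalObj_stronglyConvex hn hc y (x t)
      have h2 : 0 ≤ μ / 2 * ‖x t - y‖ ^ 2 := by positivity
      linarith) (hw t)
  refine le_trans (le_of_eq ?_) (Finset.sum_le_sum h)
  have h0 : ∑ t ∈ Finset.range T, w t • (x t - y) = 0 := by
    simp_rw [smul_sub, Finset.sum_sub_distrib, ← Finset.sum_smul, ← hSdef, hy, smul_smul,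
      mul_inv_cancel₀ hS.ne', one_smul, sub_self]
  simp_rw [mul_add, Finset.sum_add_distrib, ← Finset.sum_mul, ← hSdef, ← inner_smul_right,
    ← inner_sum, h0, inner_zero_right]
  ring

/-- The sum of powers is at most the integral of `x ^ r` over `[0, T]`. -/
lemma sum_rpow_le {r : ℝ} (hr : 0 < r) (T : ℕ) :
    ∑ t ∈ Finset.range T, (t : ℝ) ^ r ≤ (T : ℝ) ^ (r + 1) / (r + 1) := by
  induction T with
  | zero => simp; positivity
  | succ T ih =>
    rw [Finset.sum_range_succ]
    have key : (T : ℝ) ^ (r + 1) + (r + 1) * (T : ℝ) ^ r ≤ ((T + 1 : ℕ) : ℝ) ^ (r + 1) := by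
      rcases Nat.eq_zero_or_pos T with rfl | hT
      · simp [Real.zero_rpow hr.ne', Real.zero_rpow (by positivity : r + 1 ≠ 0)]
      · have hT' : (0 : ℝ) < T := by exact_mod_cast hT
        -- Bernoulli's inequality for `(1 + 1 / T) ^ (r + 1)`
        have h := one_add_mul_self_le_rpow_one_add (s := 1 / (T : ℝ))
          (by have : 0 < 1 / (T : ℝ) := by positivity
              linarith) (p := r + 1) (by linarith)
        have e : ((T + 1 : ℕ) : ℝ) = T * (1 + 1 / T) := by push_cast; field_simp
        rw [e, Real.mul_rpow hT'.le (by positivity)]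
        refine le_trans (le_of_eq ?_) (mul_le_mul_of_nonneg_left h (by positivity))
        rw [Real.rpow_add_one hT'.ne']
        field_simp
    have h2 : (T : ℝ) ^ r = (r + 1) * (T : ℝ) ^ r / (r + 1) := by field_simp
    calc _ ≤ (T : ℝ) ^ (r + 1) / (r + 1) + (r + 1) * (T : ℝ) ^ r / (r + 1) := by
          rw [← h2]; linarith
      _ ≤ _ := by rw [← add_div]; gcongr

lemma cube_div_three_le_weightSum {a : ℝ} (ha : 1 ≤ a) (T : ℕ) :
    (T : ℝ) ^ 3 / 3 ≤ weightSum a T := by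
  unfold weightSum
  induction T with
  | zero => simp
  | succ T ih =>
    rw [Finset.sum_range_succ]
    have : (0 : ℝ) ≤ T := Nat.cast_nonneg T
    push_cast
    nlinarith [mul_nonneg (sub_nonneg.2 ha) this]

/-- Summation of the perturbed contraction `u (t+1) ≤ (1 - μ η_t / 2) u t - η_t e t + …` with the
weights `(a + t)²`: by the choice of `η_t`, the quantity `μ (a + t)³ / 8 = (a + t)² / η_t`
telescopes. -/
lemma weighted_sum_le {μ a B κ K₁ K₂ c₀ ε : ℝ} {T : ℕ} (hμ : 0 < μ) (ha : 1 ≤ a)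
    (hB : 0 ≤ B) (hκ : 0 ≤ κ) (hK₂ : 0 ≤ K₂) (hc₀ : 0 ≤ c₀) (hε1 : ε < 1)
    {η u e r c : ℕ → ℝ} (hη : ∀ t : ℕ, η t = 8 / (μ * (a + t))) (hu : ∀ t, 0 ≤ u t)
    (hc : ∀ t : ℕ, c t ≤ c₀ * (t : ℝ) ^ (1 - ε))
    (hr : ∀ t < T, r t ≤ η t ^ 2 * (K₁ + K₂ * c t))
    (hrec : ∀ t < T, u (t + 1) ≤ (1 - η t * μ / 2) * u t - η t * e t + η t ^ 2 * B
      + η t * κ * r t) :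
    ∑ t ∈ Finset.range T, (a + t) ^ 2 * e t
      ≤ μ * a ^ 3 / 8 * u 0 + 4 * T * (T + 2 * a) / μ * B
        + 64 * κ / μ ^ 2 * (K₁ * T + K₂ * c₀ * ((T : ℝ) ^ (2 - ε) / (2 - ε))) := by
  have step : ∀ m ≤ T, ∑ t ∈ Finset.range m, (a + t) ^ 2 * e t + μ / 8 * (a + m - 1) ^ 3 * u m
      ≤ μ * a ^ 3 / 8 * u 0 + ∑ t ∈ Finset.range m, (8 / μ * (a + t) * B
        + 64 * κ / μ ^ 2 * (K₁ + K₂ * (c₀ * (t : ℝ) ^ (1 - ε)))) := by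
    intro m
    induction m with
    | zero =>
      intro _
      have : (a - 1) ^ 3 ≤ a ^ 3 := pow_le_pow_left₀ (by linarith) (by linarith) 3
      have := mul_le_mul_of_nonneg_right this (hu 0)
      simp
      nlinarith
    | succ m ih =>
      intro hm
      have ih := ih (by omega)
      have h1 := hrec m (by omega)
      have h2 := hr m (by omega)
      have hs : 1 ≤ a + m := by have : (0 : ℝ) ≤ m := Nat.cast_nonneg m; linarith
      rw [Finset.sum_range_succ, Finset.sum_range_succ]
      have hη' := hη m
      have hcm := hc m
      push_cast
      rw [show a + ((m : ℝ) + 1) - 1 = a + m by ring]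
      generalize a + (m : ℝ) = s at *
      have hs0 : 0 < s := by linarith
      have hηp : 0 < η m := by rw [hη']; positivity
      have w1 : s ^ 2 = μ / 8 * s ^ 3 * η m := by rw [hη']; field_simp
      have h3 : η m * κ * r m ≤ η m * κ * (η m ^ 2 * (K₁ + K₂ * (c₀ * (m : ℝ) ^ (1 - ε)))) := by
        gcongr
        refine h2.trans ?_
        gcongr
      have h4 := mul_le_mul_of_nonneg_left (h1.trans (add_le_add_right h3 _))
        (by positivity : 0 ≤ μ / 8 * s ^ 3)
      have w2 : μ / 8 * s ^ 3 * (1 - η m * μ / 2) = μ / 8 * (s ^ 3 - 4 * s ^ 2) := by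
        rw [hη']; field_simp; ring
      have w3 : μ / 8 * s ^ 3 * (η m ^ 2 * B) = 8 / μ * s * B := by
        rw [hη']; field_simp
      have w4 : μ / 8 * s ^ 3 * (η m * κ * (η m ^ 2 * (K₁ + K₂ * (c₀ * (m : ℝ) ^ (1 - ε)))))
          = 64 * κ / μ ^ 2 * (K₁ + K₂ * (c₀ * (m : ℝ) ^ (1 - ε))) := by
        rw [hη']; field_simp; ring
      have w5 : μ / 8 * (s ^ 3 - 4 * s ^ 2) * u m ≤ μ / 8 * (s - 1) ^ 3 * u m := by
        apply mul_le_mul_of_nonneg_right _ (hu m)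
        apply mul_le_mul_of_nonneg_left _ (by positivity)
        nlinarith
      have w6 : s ^ 2 * e m = μ / 8 * s ^ 3 * (η m * e m) := by rw [w1]; ring
      have e1 : μ / 8 * s ^ 3 * ((1 - η m * μ / 2) * u m - η m * e m + η m ^ 2 * B
          + η m * κ * (η m ^ 2 * (K₁ + K₂ * (c₀ * (m : ℝ) ^ (1 - ε)))))
          = μ / 8 * s ^ 3 * (1 - η m * μ / 2) * u m - μ / 8 * s ^ 3 * (η m * e m)
            + μ / 8 * s ^ 3 * (η m ^ 2 * B)
            + μ / 8 * s ^ 3 * (η m * κ * (η m ^ 2 * (K₁ + K₂ * (c₀ * (m : ℝ) ^ (1 - ε))))) := by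
        ring
      rw [e1, w2, w3, w4, ← w6] at h4
      linarith
  have h := step T le_rfl
  have h0 : 0 ≤ μ / 8 * (a + T - 1) ^ 3 * u T := by
    have : (0 : ℝ) ≤ T := Nat.cast_nonneg T
    have : 0 ≤ a + T - 1 := by linarith
    have := hu T
    positivity
  have hsum : ∑ t ∈ Finset.range T, 8 / μ * (a + t) * B ≤ 4 * T * (T + 2 * a) / μ * B := by
    rw [← Finset.sum_mul, ← Finset.mul_sum]
    apply mul_le_mul_of_nonneg_right _ hB
    have : ∀ m : ℕ, ∑ t ∈ Finset.range m, (a + t) ≤ m * (m + 2 * a) / 2 := by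
      intro m
      induction m with
      | zero => simp
      | succ m ih => rw [Finset.sum_range_succ]; push_cast; linarith
    calc _ ≤ 8 / μ * (T * (T + 2 * a) / 2) := by gcongr; exact this T
      _ = _ := by ring
  rw [Finset.sum_add_distrib, ← Finset.mul_sum, Finset.sum_add_distrib, ← Finset.mul_sum,
    ← Finset.mul_sum] at h
  have hp := sum_rpow_le (r := 1 - ε) (by linarith) T
  rw [show 1 - ε + 1 = 2 - ε by ring] at hp
  have h5 : 64 * κ / μ ^ 2 * (∑ t ∈ Finset.range T, K₁
      + K₂ * (c₀ * ∑ t ∈ Finset.range T, (t : ℝ) ^ (1 - ε)))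
      ≤ 64 * κ / μ ^ 2 * (K₁ * T + K₂ * c₀ * ((T : ℝ) ^ (2 - ε) / (2 - ε))) := by
    rw [mul_assoc K₂]
    simp only [Finset.sum_const, Finset.card_range, nsmul_eq_mul, mul_comm (T : ℝ) K₁]
    gcongr
  linarith

end SPARQ

/-! ### Second moments and independence -/

namespace SPARQ

section SecondMoments

variable {Ω : Type*} [MeasurableSpace Ω] {P : Measure Ω} {d : ℕ}

/-- A bound on the extended nonnegative integral of `‖V‖²` gives square integrability together with
the bound on the real integral. -/
lemma memLp_two_of_lintegral_le {V : Ω → Vec d} (hV : AEStronglyMeasurable V P) {b : ℝ}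
    (hb : 0 ≤ b) (h : ∫⁻ θ, ‖V θ‖ₑ ^ 2 ∂P ≤ ENNReal.ofReal b) :
    MemLp V 2 P ∧ ∫ θ, ‖V θ‖ ^ 2 ∂P ≤ b := by
  have e : ∀ θ, ENNReal.ofReal (‖V θ‖ ^ 2) = ‖V θ‖ₑ ^ 2 := fun θ => by
    rw [ENNReal.ofReal_pow (norm_nonneg _), ofReal_norm]
  have hm : AEStronglyMeasurable (fun θ => ‖V θ‖ ^ 2) P := hV.norm.pow 2
  constructor
  · rw [memLp_two_iff_integrable_sq_norm hV]
    refine ⟨hm, ?_⟩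
    rw [hasFiniteIntegral_iff_ofReal (Filter.Eventually.of_forall fun θ => sq_nonneg _)]
    simp_rw [e]
    exact h.trans_lt ENNReal.ofReal_lt_top
  · rw [integral_eq_lintegral_of_nonneg_ae (Filter.Eventually.of_forall fun θ => sq_nonneg _) hm]
    simp_rw [e]
    exact ENNReal.toReal_le_of_le_ofReal hb h

lemma integrable_norm_sq {V : Ω → Vec d} (hV : MemLp V 2 P) :
    Integrable (fun θ => ‖V θ‖ ^ 2) P :=
  (memLp_two_iff_integrable_sq_norm hV.1).1 hV

lemma integrable_inner_of_memLp {U V : Ω → Vec d} (hU : MemLp U 2 P) (hV : MemLp V 2 P) :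
    Integrable (fun θ => inner ℝ (U θ) (V θ)) P := by
  refine ((integrable_norm_sq hU).add (integrable_norm_sq hV)).mono' (hU.1.inner hV.1)
    (Filter.Eventually.of_forall fun θ => ?_)
  have h := norm_inner_le_norm (𝕜 := ℝ) (U θ) (V θ)
  simp only [Pi.add_apply]
  nlinarith [sq_nonneg (‖U θ‖ - ‖V θ‖), sq_nonneg ‖U θ‖, sq_nonneg ‖V θ‖]

lemma memLp_nodeAvg {n : ℕ} {X : Fin n → Ω → Vec d} (hX : ∀ i, MemLp (X i) 2 P) :
    MemLp (fun θ => nodeAvg fun i => X i θ) 2 P :=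
  (memLp_finsetSum Finset.univ fun i _ => hX i).const_smul (n : ℝ)⁻¹

lemma integrable_dev {n : ℕ} {X : Fin n → Ω → Vec d} (hX : ∀ i, MemLp (X i) 2 P) :
    Integrable (fun θ => dev fun i => X i θ) P :=
  integrable_finsetSum _ fun i _ => integrable_norm_sq ((hX i).sub (memLp_nodeAvg hX))

lemma integrable_sum_norm_sq {ι : Type*} (s : Finset ι) {X : ι → Ω → Vec d}
    (hX : ∀ i, MemLp (X i) 2 P) : Integrable (fun θ => ∑ i ∈ s, ‖X i θ‖ ^ 2) P :=
  integrable_finsetSum _ fun i _ => integrable_norm_sq (hX i)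

variable {α β : Type*} [MeasurableSpace α] [MeasurableSpace β] [IsProbabilityMeasure P]

/-- A second moment bound for each fixed value of `V` transfers to `V` itself if the
remaining randomness is independent of `V`. -/
lemma memLp_two_of_indepFun {V : Ω → α} {Y : Ω → β} (hV : Measurable V) (hY : Measurable Y)
    (hind : IndepFun V Y P) {Φ : α × β → Vec d} (hΦ : Measurable Φ) {B : α → ℝ}
    (hBm : Measurable B) (hB0 : ∀ v, 0 ≤ B v) (hBint : Integrable (fun θ => B (V θ)) P)
    (h : ∀ v, ∫⁻ y, ‖Φ (v, y)‖ₑ ^ 2 ∂(P.map Y) ≤ ENNReal.ofReal (B v)) :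
    MemLp (fun θ => Φ (V θ, Y θ)) 2 P ∧
      ∫ θ, ‖Φ (V θ, Y θ)‖ ^ 2 ∂P ≤ ∫ θ, B (V θ) ∂P := by
  have hVY := (indepFun_iff_map_prod_eq_prod_map_map hV.aemeasurable hY.aemeasurable).1 hind
  have hm : Measurable fun q : α × β => ‖Φ q‖ₑ ^ 2 := hΦ.enorm.pow_const 2
  have hpr : IsProbabilityMeasure (P.map Y) := Measure.isProbabilityMeasure_map hY.aemeasurable
  have hpr' : IsProbabilityMeasure (P.map V) := Measure.isProbabilityMeasure_map hV.aemeasurable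
  refine memLp_two_of_lintegral_le (hΦ.comp (hV.prodMk hY)).aestronglyMeasurable
    (integral_nonneg fun θ => hB0 _) ?_
  rw [ofReal_integral_eq_lintegral_ofReal hBint (Filter.Eventually.of_forall fun θ => hB0 _)]
  calc ∫⁻ θ, ‖Φ (V θ, Y θ)‖ₑ ^ 2 ∂P
      = ∫⁻ q, ‖Φ q‖ₑ ^ 2 ∂(P.map fun θ => (V θ, Y θ)) := (lintegral_map hm (hV.prodMk hY)).symm
    _ = ∫⁻ v, ∫⁻ y, ‖Φ (v, y)‖ₑ ^ 2 ∂(P.map Y) ∂(P.map V) := by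
        rw [hVY, lintegral_prod _ hm.aemeasurable]
    _ ≤ ∫⁻ v, ENNReal.ofReal (B v) ∂(P.map V) := lintegral_mono h
    _ = _ := lintegral_map hBm.ennreal_ofReal hV

/-- A vector is orthogonal in the mean to a noise which is centered conditionally on it. -/
lemma integral_inner_eq_zero_of_indepFun {U : Ω → Vec d} {V : Ω → α} {Y : Ω → β}
    (hU : Measurable U) (hV : Measurable V) (hY : Measurable Y)
    (hind : IndepFun (fun θ => (U θ, V θ)) Y P) {Φ : α × β → Vec d} (hΦ : Measurable Φ)
    (hint : ∀ v, Integrable (fun y => Φ (v, y)) (P.map Y))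
    (h0 : ∀ v, ∫ y, Φ (v, y) ∂(P.map Y) = 0)
    (hU2 : MemLp U 2 P) (hΦ2 : MemLp (fun θ => Φ (V θ, Y θ)) 2 P) :
    ∫ θ, inner ℝ (U θ) (Φ (V θ, Y θ)) ∂P = 0 := by
  have hUV := hU.prodMk hV
  have hVY := (indepFun_iff_map_prod_eq_prod_map_map hUV.aemeasurable hY.aemeasurable).1 hind
  have hpr : IsProbabilityMeasure (P.map Y) := Measure.isProbabilityMeasure_map hY.aemeasurable
  have hpr' : IsProbabilityMeasure (P.map fun θ => (U θ, V θ)) :=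
    Measure.isProbabilityMeasure_map hUV.aemeasurable
  set F : (Vec d × α) × β → ℝ := fun q => inner ℝ q.1.1 (Φ (q.1.2, q.2)) with hF
  have hFm : Measurable F :=
    measurable_fst.fst.inner (hΦ.comp (measurable_fst.snd.prodMk measurable_snd))
  have hFint : Integrable F (P.map fun θ => ((U θ, V θ), Y θ)) :=
    (integrable_map_measure hFm.aestronglyMeasurable (hUV.prodMk hY).aemeasurable).2
      (integrable_inner_of_memLp hU2 hΦ2)
  calc ∫ θ, inner ℝ (U θ) (Φ (V θ, Y θ)) ∂P
      = ∫ q, F q ∂(P.map fun θ => ((U θ, V θ), Y θ)) :=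
        (integral_map (hUV.prodMk hY).aemeasurable hFm.aestronglyMeasurable).symm
    _ = ∫ w, ∫ y, F (w, y) ∂(P.map Y) ∂(P.map fun θ => (U θ, V θ)) := by
        rw [hVY] at hFint ⊢; exact integral_prod _ hFint
    _ = ∫ w, (0 : ℝ) ∂(P.map fun θ => (U θ, V θ)) := by
        congr 1
        ext w
        simp only [hF]
        rw [integral_inner (hint w.2), h0, inner_zero_right]
    _ = 0 := integral_zero _ _

end SecondMoments

section Measurability

variable {n d : ℕ} {Ω Ξ Z : Type*}

/-- The message of a node as a function of the difference between its parameter and its estimate,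
for the squared triggering threshold `τ`. -/
noncomputable def trigger (C : Vec d → Z → Vec d) (τ : ℝ) (v : Vec d) (z : Z) : Vec d :=
  open Classical in if τ < ‖v‖ ^ 2 then C v z else 0

lemma measurable_trigger [MeasurableSpace Z] {C : Vec d → Z → Vec d}
    (hC : Measurable (Function.uncurry C)) (τ : ℝ) :
    Measurable (Function.uncurry (trigger C τ)) := by
  classical
  refine Measurable.ite (p := fun q : Vec d × Z => τ < ‖q.1‖ ^ 2) ?_ hC measurable_const
  exact measurableSet_lt measurable_const (measurable_fst.norm.pow_const 2)

lemma run_succ (A : Input n d Ξ Z) (ξ : ℕ → Fin n → Ω → Ξ) (ζ : ℕ → Fin n → Ω → Z) (t : ℕ)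
    (θ : Ω) :
    run A ξ ζ (t + 1) θ = step A t (run A ξ ζ t θ) (fun i => ξ t i θ) (fun i => ζ t i θ) := rfl

/-- The parameters after the local step of iteration `t`. -/
noncomputable def localStep (A : Input n d Ξ Z) (ξ : ℕ → Fin n → Ω → Ξ) (ζ : ℕ → Fin n → Ω → Z)
    (t : ℕ) (i : Fin n) (θ : Ω) : Vec d :=
  half A t (run A ξ ζ t θ).x (fun i => ξ t i θ) i

/-- The estimates after the messages of iteration `t`, if it is a synchronization round. -/
noncomputable def newEstimate (A : Input n d Ξ Z) (ξ : ℕ → Fin n → Ω → Ξ)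
    (ζ : ℕ → Fin n → Ω → Z) (t : ℕ) (i : Fin n) (θ : Ω) : Vec d :=
  syncHat A t (run A ξ ζ t θ) (fun i => ξ t i θ) (fun i => ζ t i θ) i

lemma run_succ_of_mem (A : Input n d Ξ Z) (ξ : ℕ → Fin n → Ω → Ξ) (ζ : ℕ → Fin n → Ω → Z)
    {t : ℕ} (h : t + 1 ∈ A.I) (θ : Ω) :
    run A ξ ζ (t + 1) θ =
      { x := fun i => localStep A ξ ζ t i θ
          + A.γ • ∑ j, (A.W - (1 : Matrix (Fin n) (Fin n) ℝ)) j i • newEstimate A ξ ζ t j θ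
        xhat := fun i => newEstimate A ξ ζ t i θ } := by
  rw [run_succ, step, if_pos h]; rfl

lemma run_succ_of_notMem (A : Input n d Ξ Z) (ξ : ℕ → Fin n → Ω → Ξ) (ζ : ℕ → Fin n → Ω → Z)
    {t : ℕ} (h : t + 1 ∉ A.I) (θ : Ω) :
    run A ξ ζ (t + 1) θ =
      { x := fun i => localStep A ξ ζ t i θ
        xhat := (run A ξ ζ t θ).xhat } := by
  rw [run_succ, step, if_neg h]; rfl

/-- The state at time `t` is a measurable function of the random variables of the times before
`t`. The σ-algebra of the sample space is arbitrary: the lemma is used for σ-algebras generated by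
part of the randomness. -/
lemma measurable_run [MeasurableSpace Ξ] [MeasurableSpace Z] {mΩ : MeasurableSpace Ω}
    {A : Input n d Ξ Z}
    (hg : ∀ i, Measurable (Function.uncurry (A.gradF i))) (hC : Measurable (Function.uncurry A.C))
    {ξ : ℕ → Fin n → Ω → Ξ} {ζ : ℕ → Fin n → Ω → Z} (t : ℕ)
    (hξ : ∀ u < t, ∀ i, Measurable (ξ u i)) (hζ : ∀ u < t, ∀ i, Measurable (ζ u i)) :
    (∀ i, Measurable fun θ => (run A ξ ζ t θ).x i) ∧
      ∀ i, Measurable fun θ => (run A ξ ζ t θ).xhat i := by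
  induction t with
  | zero => exact ⟨fun i => measurable_const, fun i => measurable_const⟩
  | succ t ih =>
    obtain ⟨ihx, ihh⟩ := ih (fun u hu => hξ u (by omega)) (fun u hu => hζ u (by omega))
    have hl : ∀ i, Measurable (localStep A ξ ζ t i) := fun i => by
      have h : Measurable fun θ => A.gradF i ((run A ξ ζ t θ).x i) (ξ t i θ) :=
        (hg i).comp ((ihx i).prodMk (hξ t (by omega) i))
      exact (ihx i).sub (h.const_smul (A.η t))
    have he : ∀ i, Measurable (newEstimate A ξ ζ t i) := fun i => by
      have h1 : Measurable fun θ =>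
          (localStep A ξ ζ t i θ - (run A ξ ζ t θ).xhat i, ζ t i θ) :=
        ((hl i).sub (ihh i)).prodMk (hζ t (by omega) i)
      have h2 := (measurable_trigger hC (A.c t * A.η t ^ 2)).comp h1
      exact (ihh i).add h2
    by_cases h : t + 1 ∈ A.I
    · simp_rw [run_succ_of_mem A ξ ζ h]
      refine ⟨fun i => (hl i).add (Measurable.const_smul ?_ A.γ), he⟩
      exact Finset.measurable_sum _ fun j _ => (he j).fun_const_smul _
    · simp_rw [run_succ_of_notMem A ξ ζ h]
      exact ⟨hl, ihh⟩

end Measurability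

section Sampling

variable {n : ℕ} {Ω Ξ Z : Type*} [MeasurableSpace Ξ] [MeasurableSpace Z]
  {ξ : ℕ → Fin n → Ω → Ξ} {ζ : ℕ → Fin n → Ω → Z}

/-- The σ-algebra generated by a single random variable of the sampling. -/
abbrev noiseAlgebra (ξ : ℕ → Fin n → Ω → Ξ) (ζ : ℕ → Fin n → Ω → Z) :
    (ℕ × Fin n) ⊕ (ℕ × Fin n) → MeasurableSpace Ω :=
  Sum.elim (fun q => MeasurableSpace.comap (ξ q.1 q.2) inferInstance)
    (fun q => MeasurableSpace.comap (ζ q.1 q.2) inferInstance)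

/-- The σ-algebra generated by all random variables of the sampling but one. -/
abbrev otherNoise (ξ : ℕ → Fin n → Ω → Ξ) (ζ : ℕ → Fin n → Ω → Z)
    (q : (ℕ × Fin n) ⊕ (ℕ × Fin n)) : MeasurableSpace Ω :=
  ⨆ q' ∈ ({q}ᶜ : Set _), noiseAlgebra ξ ζ q'

lemma measurable_data_otherNoise {q : (ℕ × Fin n) ⊕ (ℕ × Fin n)} {t : ℕ} {i : Fin n}
    (h : Sum.inl (t, i) ≠ q) : Measurable[otherNoise ξ ζ q] (ξ t i) :=
  Measurable.of_comap_le (le_biSup (noiseAlgebra ξ ζ) (Set.mem_compl_singleton_iff.2 h))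

lemma measurable_comp_otherNoise {q : (ℕ × Fin n) ⊕ (ℕ × Fin n)} {t : ℕ} {i : Fin n}
    (h : Sum.inr (t, i) ≠ q) : Measurable[otherNoise ξ ζ q] (ζ t i) :=
  Measurable.of_comap_le (le_biSup (noiseAlgebra ξ ζ) (Set.mem_compl_singleton_iff.2 h))

variable [MeasurableSpace Ω] {P : Measure Ω} {D : Fin n → Measure Ξ} {ν : Measure Z}

lemma IsSampling.noiseAlgebra_le (h : IsSampling P D ν ξ ζ) (q : (ℕ × Fin n) ⊕ (ℕ × Fin n)) :
    noiseAlgebra ξ ζ q ≤ ‹MeasurableSpace Ω› := by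
  rcases q with q | q
  · exact (h.meas_data q.1 q.2).comap_le
  · exact (h.meas_comp q.1 q.2).comap_le

lemma IsSampling.indep_otherNoise (h : IsSampling P D ν ξ ζ) (q : (ℕ × Fin n) ⊕ (ℕ × Fin n)) :
    Indep (otherNoise ξ ζ q) (noiseAlgebra ξ ζ q) P := by
  have := indep_iSup_of_disjoint h.noiseAlgebra_le h.indep
    (disjoint_compl_left : Disjoint ({q}ᶜ : Set _) {q})
  simpa [otherNoise] using this

lemma IsSampling.indepFun_data (h : IsSampling P D ν ξ ζ) {α : Type*} [MeasurableSpace α]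
    {V : Ω → α} {t : ℕ} {i : Fin n} (hV : Measurable[otherNoise ξ ζ (.inl (t, i))] V) :
    IndepFun V (ξ t i) P :=
  indep_of_indep_of_le_left (h.indep_otherNoise (.inl (t, i))) hV.comap_le

lemma IsSampling.indepFun_comp (h : IsSampling P D ν ξ ζ) {α : Type*} [MeasurableSpace α]
    {V : Ω → α} {t : ℕ} {i : Fin n} (hV : Measurable[otherNoise ξ ζ (.inr (t, i))] V) :
    IndepFun V (ζ t i) P :=
  indep_of_indep_of_le_left (h.indep_otherNoise (.inr (t, i))) hV.comap_le

end Sampling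

end SPARQ

/-! ### Moments along a run and the descent of the mean -/

namespace SPARQ

lemma measurable_gradient {d : ℕ} (f : Vec d → ℝ) : Measurable fun x => gradient f x :=
  (InnerProductSpace.toDual ℝ (Vec d)).symm.continuous.measurable.comp (measurable_fderiv ℝ f)

/-- The probabilistic assumptions on a run of SPARQ-SGD up to the horizon `T`. -/
structure IsRun {n d : ℕ} {Ω Ξ Z : Type*} [MeasurableSpace Ω] [MeasurableSpace Ξ]
    [MeasurableSpace Z] (P : Measure Ω) (D : Fin n → Measure Ξ) (ν : Measure Z)
    (f : Fin n → Vec d → ℝ) (G ω : ℝ) (σ : Fin n → ℝ) (T : ℕ) (A : Input n d Ξ Z)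
    (ξ : ℕ → Fin n → Ω → Ξ) (ζ : ℕ → Fin n → Ω → Z) : Prop where
  samp : IsSampling P D ν ξ ζ
  gmeas : ∀ i, Measurable (Function.uncurry (A.gradF i))
  unbiased : ∀ i x, ∫ s, A.gradF i x s ∂(D i) = gradient (f i) x
  var : ∀ i x, ∫⁻ s, ‖A.gradF i x s - gradient (f i) x‖ₑ ^ 2 ∂(D i) ≤ ENNReal.ofReal (σ i ^ 2)
  second : ∀ t < T, ∀ i,
    ∫⁻ θ, ‖A.gradF i ((run A ξ ζ t θ).x i) (ξ t i θ)‖ₑ ^ 2 ∂P ≤ ENNReal.ofReal (G ^ 2)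
  ω_pos : 0 < ω
  ω_le : ω ≤ 1
  Cmeas : Measurable (Function.uncurry A.C)
  compr : IsCompression ω ν A.C
  c_nonneg : ∀ t, 0 ≤ A.c t

/-- The stochastic gradient of node `i` in iteration `t`. -/
noncomputable def stochGrad {n d : ℕ} {Ω Ξ Z : Type*} (A : Input n d Ξ Z)
    (ξ : ℕ → Fin n → Ω → Ξ) (ζ : ℕ → Fin n → Ω → Z) (t : ℕ) (i : Fin n) (θ : Ω) : Vec d :=
  A.gradF i ((run A ξ ζ t θ).x i) (ξ t i θ)

/-- The noise of the stochastic gradient of node `i` in iteration `t`. -/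
noncomputable def gradNoise {n d : ℕ} {Ω Ξ Z : Type*} (f : Fin n → Vec d → ℝ) (A : Input n d Ξ Z)
    (ξ : ℕ → Fin n → Ω → Ξ) (ζ : ℕ → Fin n → Ω → Z) (t : ℕ) (i : Fin n) (θ : Ω) : Vec d :=
  stochGrad A ξ ζ t i θ - gradient (f i) ((run A ξ ζ t θ).x i)

lemma measurable_nodeAvg {n d : ℕ} {Ω : Type*} {mΩ : MeasurableSpace Ω} {X : Fin n → Ω → Vec d}
    (hX : ∀ i, Measurable (X i)) : Measurable fun θ => nodeAvg fun i => X i θ :=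
  (Finset.measurable_sum _ fun i _ => hX i).fun_const_smul _

lemma nodeAvg_sub {n d : ℕ} (X Y : Fin n → Vec d) :
    (nodeAvg fun i => X i - Y i) = nodeAvg X - nodeAvg Y := by
  simp [nodeAvg, smul_sub]

lemma nodeAvg_smul {n d : ℕ} (r : ℝ) (X : Fin n → Vec d) :
    (nodeAvg fun i => r • X i) = r • nodeAvg X := by
  simp [nodeAvg, Finset.smul_sum, smul_smul, mul_comm]

lemma localStep_eq {n d : ℕ} {Ω Ξ Z : Type*} (A : Input n d Ξ Z)
    (ξ : ℕ → Fin n → Ω → Ξ) (ζ : ℕ → Fin n → Ω → Z) (t : ℕ) (i : Fin n) (θ : Ω) :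
    localStep A ξ ζ t i θ = (run A ξ ζ t θ).x i - A.η t • stochGrad A ξ ζ t i θ := rfl

/-- The mean makes a plain stochastic gradient step in every iteration, as gossip preserves it. -/
lemma nodeAvg_run_succ {n d : ℕ} {Ω Ξ Z : Type*} (A : Input n d Ξ Z)
    (hW : IsDoublyStochasticSymm A.W)
    (ξ : ℕ → Fin n → Ω → Ξ) (ζ : ℕ → Fin n → Ω → Z) (t : ℕ) (θ : Ω) :
    nodeAvg (run A ξ ζ (t + 1) θ).x
      = nodeAvg (run A ξ ζ t θ).x - A.η t • nodeAvg fun i => stochGrad A ξ ζ t i θ := by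
  have h : nodeAvg (run A ξ ζ (t + 1) θ).x = nodeAvg fun i => localStep A ξ ζ t i θ := by
    by_cases h : t + 1 ∈ A.I
    · rw [run_succ_of_mem A ξ ζ h]
      exact nodeAvg_gossip hW _ _ _
    · rw [run_succ_of_notMem A ξ ζ h]
  rw [h]
  simp_rw [localStep_eq]
  rw [nodeAvg_sub, nodeAvg_smul]

lemma measurable_stochGrad_of {n d : ℕ} {Ω Ξ Z : Type*} [MeasurableSpace Ξ]
    {mΩ : MeasurableSpace Ω} {A : Input n d Ξ Z} {ξ : ℕ → Fin n → Ω → Ξ} {ζ : ℕ → Fin n → Ω → Z}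
    {t : ℕ} {i : Fin n} (hg : Measurable (Function.uncurry (A.gradF i)))
    (hx : Measurable fun θ => (run A ξ ζ t θ).x i) (hξ : Measurable (ξ t i)) :
    Measurable (stochGrad A ξ ζ t i) :=
  hg.comp (hx.prodMk hξ)

lemma measurable_localStep_sub_of {n d : ℕ} {Ω Ξ Z : Type*} [MeasurableSpace Ξ]
    {mΩ : MeasurableSpace Ω} {A : Input n d Ξ Z} {ξ : ℕ → Fin n → Ω → Ξ} {ζ : ℕ → Fin n → Ω → Z}
    {t : ℕ} {i : Fin n} (hg : Measurable (Function.uncurry (A.gradF i)))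
    (hx : (∀ i, Measurable fun θ => (run A ξ ζ t θ).x i) ∧
      ∀ i, Measurable fun θ => (run A ξ ζ t θ).xhat i) (hξ : Measurable (ξ t i)) :
    Measurable fun θ => localStep A ξ ζ t i θ - (run A ξ ζ t θ).xhat i := by
  have h := (measurable_stochGrad_of hg (hx.1 i) hξ).fun_const_smul (A.η t)
  exact ((hx.1 i).sub h).sub (hx.2 i)

lemma integral_sub_add {Ω : Type*} [MeasurableSpace Ω] {P : Measure Ω} {u v w : Ω → ℝ}
    (hu : Integrable u P) (hv : Integrable v P) (hw : Integrable w P) :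
    ∫ θ, (u θ - v θ + w θ) ∂P = ∫ θ, u θ ∂P - ∫ θ, v θ ∂P + ∫ θ, w θ ∂P := by
  have h : Integrable (fun θ => u θ - v θ) P := hu.sub hv
  rw [integral_add h hw, integral_sub hu hv]

namespace IsRun

variable {n d : ℕ} {Ω Ξ Z : Type*} [MeasurableSpace Ω] [MeasurableSpace Ξ]
    [MeasurableSpace Z] {P : Measure Ω} {D : Fin n → Measure Ξ} {ν : Measure Z}
    {f : Fin n → Vec d → ℝ} {G ω : ℝ} {σ : Fin n → ℝ} {T : ℕ} {A : Input n d Ξ Z}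
    {ξ : ℕ → Fin n → Ω → Ξ} {ζ : ℕ → Fin n → Ω → Z}

lemma measurable_x (h : IsRun P D ν f G ω σ T A ξ ζ) (t : ℕ) (i : Fin n) :
    Measurable fun θ => (run A ξ ζ t θ).x i :=
  (measurable_run h.gmeas h.Cmeas t (fun u _ i => h.samp.meas_data u i)
    fun u _ i => h.samp.meas_comp u i).1 i

lemma measurable_xhat (h : IsRun P D ν f G ω σ T A ξ ζ) (t : ℕ) (i : Fin n) :
    Measurable fun θ => (run A ξ ζ t θ).xhat i :=
  (measurable_run h.gmeas h.Cmeas t (fun u _ i => h.samp.meas_data u i)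
    fun u _ i => h.samp.meas_comp u i).2 i

lemma measurable_stochGrad (h : IsRun P D ν f G ω σ T A ξ ζ) (t : ℕ) (i : Fin n) :
    Measurable (stochGrad A ξ ζ t i) :=
  (h.gmeas i).comp ((h.measurable_x t i).prodMk (h.samp.meas_data t i))

lemma measurable_localStep (h : IsRun P D ν f G ω σ T A ξ ζ) (t : ℕ) (i : Fin n) :
    Measurable (localStep A ξ ζ t i) :=
  (h.measurable_x t i).sub ((h.measurable_stochGrad t i).fun_const_smul _)

/-- The state at time `t` does not depend on the data samples of iteration `t`. -/
lemma measurable_x_other_data (h : IsRun P D ν f G ω σ T A ξ ζ) (t : ℕ) (i j : Fin n) :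
    Measurable[otherNoise ξ ζ (.inl (t, j))] fun θ => (run A ξ ζ t θ).x i :=
  (measurable_run (mΩ := otherNoise ξ ζ (.inl (t, j))) h.gmeas h.Cmeas t
    (fun u hu i => measurable_data_otherNoise (by simp; omega))
    fun u hu i => measurable_comp_otherNoise (by simp)).1 i

lemma measurable_stochGrad_other_data (h : IsRun P D ν f G ω σ T A ξ ζ) (t : ℕ) {i j : Fin n}
    (hij : i ≠ j) : Measurable[otherNoise ξ ζ (.inl (t, j))] (stochGrad A ξ ζ t i) :=
  measurable_stochGrad_of (mΩ := otherNoise ξ ζ (.inl (t, j))) (h.gmeas i)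
    (h.measurable_x_other_data t i j) (measurable_data_otherNoise (by simpa using hij))

lemma measurable_gradNoise_other_data (h : IsRun P D ν f G ω σ T A ξ ζ) (t : ℕ) {i j : Fin n}
    (hij : i ≠ j) : Measurable[otherNoise ξ ζ (.inl (t, j))] (gradNoise f A ξ ζ t i) :=
  Measurable.sub (m := otherNoise ξ ζ (.inl (t, j))) (h.measurable_stochGrad_other_data t hij)
    ((measurable_gradient (f i)).comp (h.measurable_x_other_data t i j))

/-- The difference between the parameter and its estimate does not depend on the internal
randomness of the compression of iteration `t`. -/
lemma measurable_sub_xhat_other_comp (h : IsRun P D ν f G ω σ T A ξ ζ) (t : ℕ) (i j : Fin n) :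
    Measurable[otherNoise ξ ζ (.inr (t, j))]
      fun θ => localStep A ξ ζ t i θ - (run A ξ ζ t θ).xhat i := by
  exact measurable_localStep_sub_of (mΩ := otherNoise ξ ζ (.inr (t, j))) (h.gmeas i)
    (measurable_run (mΩ := otherNoise ξ ζ (.inr (t, j))) h.gmeas h.Cmeas t
      (fun u _ i => measurable_data_otherNoise (by simp))
      (fun u hu i => measurable_comp_otherNoise (by simp; omega)))
    (measurable_data_otherNoise (by simp))

lemma memLp_stochGrad (h : IsRun P D ν f G ω σ T A ξ ζ) {t : ℕ} (ht : t < T) (i : Fin n) :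
    MemLp (stochGrad A ξ ζ t i) 2 P ∧ ∫ θ, ‖stochGrad A ξ ζ t i θ‖ ^ 2 ∂P ≤ G ^ 2 :=
  memLp_two_of_lintegral_le (h.measurable_stochGrad t i).aestronglyMeasurable (sq_nonneg _)
    (h.second t ht i)

variable [IsProbabilityMeasure P]

/-- In a synchronization round, the error of the estimates is reduced by the factor `1 - ω`, up
to the triggering threshold. -/
lemma memLp_estimate_error (h : IsRun P D ν f G ω σ T A ξ ζ) (t : ℕ) (i : Fin n)
    (hL : MemLp (fun θ => localStep A ξ ζ t i θ - (run A ξ ζ t θ).xhat i) 2 P) :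
    MemLp (fun θ => localStep A ξ ζ t i θ - newEstimate A ξ ζ t i θ) 2 P ∧
      ∫ θ, ‖localStep A ξ ζ t i θ - newEstimate A ξ ζ t i θ‖ ^ 2 ∂P
        ≤ (1 - ω) * ∫ θ, ‖localStep A ξ ζ t i θ - (run A ξ ζ t θ).xhat i‖ ^ 2 ∂P
          + ω * (A.c t * A.η t ^ 2) := by
  set τ := A.c t * A.η t ^ 2 with hτ
  have hτ0 : 0 ≤ τ := mul_nonneg (h.c_nonneg t) (sq_nonneg _)
  have hω := h.ω_pos
  have hω1 := sub_nonneg.2 h.ω_le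
  have key := memLp_two_of_indepFun (P := P)
    ((h.measurable_localStep t i).sub (h.measurable_xhat t i))
    (h.samp.meas_comp t i) (h.samp.indepFun_comp (h.measurable_sub_xhat_other_comp t i i))
    (Φ := fun q => q.1 - trigger A.C τ q.1 q.2)
    (measurable_fst.sub (measurable_trigger h.Cmeas τ))
    (B := fun v => (1 - ω) * ‖v‖ ^ 2 + ω * τ)
    (((measurable_norm.pow_const 2).const_mul _).add_const _)
    (fun v => by positivity)
    (((integrable_norm_sq hL).const_mul _).add (integrable_const _)) ?_
  · have e : ∫ θ, ((1 - ω) * ‖localStep A ξ ζ t i θ - (run A ξ ζ t θ).xhat i‖ ^ 2 + ω * τ) ∂P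
        = (1 - ω) * ∫ θ, ‖localStep A ξ ζ t i θ - (run A ξ ζ t θ).xhat i‖ ^ 2 ∂P + ω * τ := by
      rw [integral_add ((integrable_norm_sq hL).const_mul _) (integrable_const _),
        integral_const_mul]
      simp
    have e2 : ∀ θ, localStep A ξ ζ t i θ - newEstimate A ξ ζ t i θ
        = (localStep A ξ ζ t i θ - (run A ξ ζ t θ).xhat i)
          - trigger A.C τ (localStep A ξ ζ t i θ - (run A ξ ζ t θ).xhat i) (ζ t i θ) := fun θ => by
      rw [sub_sub]; rfl
    simp_rw [e2, ← e]
    exact key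
  · intro v
    rw [h.samp.law_comp]
    by_cases hv : τ < ‖v‖ ^ 2
    · have e : ∀ z, v - trigger A.C τ v z = -(A.C v z - v) := fun z => by
        rw [trigger, if_pos hv, neg_sub]
      simp_rw [e, enorm_neg]
      refine (h.compr v).trans (ENNReal.ofReal_le_ofReal ?_)
      linarith [mul_nonneg hω.le hτ0]
    · have e : ∀ z, v - trigger A.C τ v z = v := fun z => by
        rw [trigger, if_neg hv, sub_zero]
      have hpr : IsProbabilityMeasure ν := by
        rw [← h.samp.law_comp t i]
        exact Measure.isProbabilityMeasure_map (h.samp.meas_comp t i).aemeasurable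
      simp_rw [e]
      rw [lintegral_const, measure_univ, mul_one, ← ofReal_norm,
        ← ENNReal.ofReal_pow (norm_nonneg _)]
      refine ENNReal.ofReal_le_ofReal ?_
      nlinarith

/-- All iterates up to the horizon are square integrable; the boundedness of the second moments of
the messages follows from the compression property. -/
lemma memLp_state (h : IsRun P D ν f G ω σ T A ξ ζ) {t : ℕ} (ht : t ≤ T) :
    (∀ i, MemLp (fun θ => (run A ξ ζ t θ).x i) 2 P) ∧
      ∀ i, MemLp (fun θ => (run A ξ ζ t θ).xhat i) 2 P := by
  induction t with
  | zero => exact ⟨fun i => memLp_const _, fun i => memLp_const _⟩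
  | succ t ih =>
    obtain ⟨ihx, ihh⟩ := ih (by omega)
    have hl : ∀ i, MemLp (localStep A ξ ζ t i) 2 P := fun i => by
      have hg := (h.memLp_stochGrad (show t < T by omega) i).1.const_smul (A.η t)
      exact (ihx i).sub hg
    have he : ∀ i, MemLp (newEstimate A ξ ζ t i) 2 P := fun i => by
      have := (hl i).sub (h.memLp_estimate_error t i ((hl i).sub (ihh i))).1
      refine this.ae_eq (Filter.Eventually.of_forall fun θ => ?_)
      simp
    by_cases hI : t + 1 ∈ A.I
    · simp_rw [run_succ_of_mem A ξ ζ hI]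
      refine ⟨fun i => (hl i).add (MemLp.const_smul ?_ A.γ), he⟩
      exact memLp_finsetSum _ fun j _ =>
        (he j).const_smul ((A.W - (1 : Matrix (Fin n) (Fin n) ℝ)) j i)
    · simp_rw [run_succ_of_notMem A ξ ζ hI]
      exact ⟨hl, ihh⟩

lemma memLp_localStep (h : IsRun P D ν f G ω σ T A ξ ζ) {t : ℕ} (ht : t < T) (i : Fin n) :
    MemLp (localStep A ξ ζ t i) 2 P := by
  have hg := (h.memLp_stochGrad ht i).1.const_smul (A.η t)
  exact ((h.memLp_state ht.le).1 i).sub hg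

/-- The noise of the stochastic gradients has second moment at most `σᵢ²`. -/
lemma memLp_gradNoise (h : IsRun P D ν f G ω σ T A ξ ζ) (t : ℕ) (i : Fin n) :
    MemLp (gradNoise f A ξ ζ t i) 2 P ∧ ∫ θ, ‖gradNoise f A ξ ζ t i θ‖ ^ 2 ∂P ≤ σ i ^ 2 := by
  have key := memLp_two_of_indepFun (P := P) (h.measurable_x t i) (h.samp.meas_data t i)
    (h.samp.indepFun_data (h.measurable_x_other_data t i i))
    (Φ := fun q => A.gradF i q.1 q.2 - gradient (f i) q.1)
    ((h.gmeas i).sub ((measurable_gradient (f i)).comp measurable_fst))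
    (B := fun _ => σ i ^ 2) measurable_const (fun _ => sq_nonneg _) (integrable_const _)
    (fun v => by rw [h.samp.law_data]; exact h.var i v)
  simp only [integral_const, probReal_univ, one_smul] at key
  exact key

lemma memLp_gradient (h : IsRun P D ν f G ω σ T A ξ ζ) {t : ℕ} (ht : t < T) (i : Fin n) :
    MemLp (fun θ => gradient (f i) ((run A ξ ζ t θ).x i)) 2 P := by
  have := (h.memLp_stochGrad ht i).1.sub (h.memLp_gradNoise t i).1
  refine this.ae_eq (Filter.Eventually.of_forall fun θ => ?_)
  simp [gradNoise]

/-- The oracle noise at a fixed point is integrable by the variance bound, so that the unbiasedness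
is not about a default value of the integral. -/
lemma integrable_gradF_sub (h : IsRun P D ν f G ω σ T A ξ ζ) (i : Fin n)
    (x : Vec d) : Integrable (fun s => A.gradF i x s - gradient (f i) x) (D i) ∧
      ∫ s, (A.gradF i x s - gradient (f i) x) ∂(D i) = 0 := by
  have hpr : IsProbabilityMeasure (D i) := by
    rw [← h.samp.law_data 0 i]
    exact Measure.isProbabilityMeasure_map (h.samp.meas_data 0 i).aemeasurable
  have hm : Measurable fun s => A.gradF i x s := (h.gmeas i).comp measurable_prodMk_left
  have h1 := (memLp_two_of_lintegral_le (hm.sub_const _).aestronglyMeasurable (sq_nonneg _)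
    (h.var i x)).1.integrable one_le_two
  have h2 : Integrable (fun s => A.gradF i x s) (D i) := by
    have := h1.add (integrable_const (gradient (f i) x))
    refine this.congr (Filter.Eventually.of_forall fun θ => ?_)
    simp
  refine ⟨h1, ?_⟩
  rw [integral_sub h2 (integrable_const _), h.unbiased]
  simp

/-- The noise of node `j` is orthogonal to all vectors that do not depend on the sample of node
`j`. -/
lemma integral_inner_gradNoise (h : IsRun P D ν f G ω σ T A ξ ζ) (t : ℕ) (j : Fin n)
    {U : Ω → Vec d} (hU : Measurable U) (hU2 : MemLp U 2 P)
    (hU' : Measurable[otherNoise ξ ζ (.inl (t, j))] U) :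
    ∫ θ, inner ℝ (U θ) (gradNoise f A ξ ζ t j θ) ∂P = 0 := by
  refine integral_inner_eq_zero_of_indepFun (P := P) hU (h.measurable_x t j) (h.samp.meas_data t j)
    (h.samp.indepFun_data (Measurable.prodMk (m := otherNoise ξ ζ (.inl (t, j))) hU'
      (h.measurable_x_other_data t j j)))
    (Φ := fun q => A.gradF j q.1 q.2 - gradient (f j) q.1)
    ((h.gmeas j).sub ((measurable_gradient (f j)).comp measurable_fst)) ?_ ?_ hU2
    (h.memLp_gradNoise t j).1
  · intro v; rw [h.samp.law_data]; exact (h.integrable_gradF_sub j v).1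
  · intro v; rw [h.samp.law_data]; exact (h.integrable_gradF_sub j v).2

/-- Averaging over the nodes divides the variance of the noise by `n`. -/
lemma integral_norm_nodeAvg_gradNoise_sq_le (h : IsRun P D ν f G ω σ T A ξ ζ) (hn : 0 < n)
    (t : ℕ) :
    ∫ θ, ‖nodeAvg fun i => gradNoise f A ξ ζ t i θ‖ ^ 2 ∂P ≤ ((∑ i, σ i ^ 2) / n) / n := by
  have hn' : (0 : ℝ) < n := by exact_mod_cast hn
  have hN := fun i => (h.memLp_gradNoise t i).1
  have hm : ∀ i, Measurable (gradNoise f A ξ ζ t i) := fun i =>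
    (h.measurable_stochGrad t i).sub ((measurable_gradient (f i)).comp (h.measurable_x t i))
  have e : ∀ θ, ‖nodeAvg fun i => gradNoise f A ξ ζ t i θ‖ ^ 2
      = (n : ℝ)⁻¹ ^ 2 * ∑ i, ∑ j, inner ℝ (gradNoise f A ξ ζ t i θ) (gradNoise f A ξ ζ t j θ) := by
    intro θ
    rw [nodeAvg, norm_smul, mul_pow, Real.norm_eq_abs, sq_abs, ← real_inner_self_eq_norm_sq,
      sum_inner]
    simp_rw [inner_sum]
  simp_rw [e]
  rw [integral_const_mul, integral_finsetSum _ fun i _ => integrable_finsetSum _ fun j _ =>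
    integrable_inner_of_memLp (hN i) (hN j)]
  have e2 : ∀ i, ∫ θ, ∑ j, inner ℝ (gradNoise f A ξ ζ t i θ) (gradNoise f A ξ ζ t j θ) ∂P
      ≤ σ i ^ 2 := by
    intro i
    rw [integral_finsetSum _ fun j _ => integrable_inner_of_memLp (hN i) (hN j),
      Finset.sum_eq_single i]
    · simp_rw [real_inner_self_eq_norm_sq]
      exact (h.memLp_gradNoise t i).2
    · intro j _ hj
      exact h.integral_inner_gradNoise t j (hm i) (hN i)
        (h.measurable_gradNoise_other_data t hj.symm)
    · simp
  calc _ ≤ (n : ℝ)⁻¹ ^ 2 * ∑ i, σ i ^ 2 := by gcongr with i; exact e2 i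
    _ = _ := by field_simp

/-- One iteration of the mean, in expectation. -/
lemma integral_norm_nodeAvg_succ_le (h : IsRun P D ν f G ω σ T A ξ ζ) (hn : 0 < n)
    {L μ : ℝ} (hμ : 0 < μ) (hs : ∀ i, IsLSmooth L (f i)) (hc : ∀ i, IsStronglyConvex μ (f i))
    {xstar : Vec d} (hx : ∀ x, globalObj f xstar ≤ globalObj f x)
    (hW : IsDoublyStochasticSymm A.W) {t : ℕ} (ht : t < T) (hη : 0 ≤ A.η t)
    (hηL : A.η t * L ≤ 1 / 4)
    (hF : Integrable (fun θ => globalObj f (nodeAvg (run A ξ ζ t θ).x)) P) :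
    ∫ θ, ‖nodeAvg (run A ξ ζ (t + 1) θ).x - xstar‖ ^ 2 ∂P
      ≤ (1 - A.η t * μ / 2) * ∫ θ, ‖nodeAvg (run A ξ ζ t θ).x - xstar‖ ^ 2 ∂P
        - A.η t * (∫ θ, globalObj f (nodeAvg (run A ξ ζ t θ).x) ∂P - globalObj f xstar)
        + A.η t ^ 2 * (((∑ i, σ i ^ 2) / n) / n)
        + A.η t * (2 * L + μ) * ((n : ℝ)⁻¹ * ∫ θ, dev (run A ξ ζ t θ).x ∂P) := by
  have hX := (h.memLp_state ht.le).1
  have hXa := memLp_nodeAvg hX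
  have hXs : MemLp (fun θ => nodeAvg (run A ξ ζ t θ).x - xstar) 2 P := hXa.sub (memLp_const _)
  have hN := fun i => (h.memLp_gradNoise t i).1
  have hNa := memLp_nodeAvg hN
  set M : Ω → Vec d := fun θ => nodeAvg (run A ξ ζ t θ).x - xstar
    - A.η t • nodeAvg fun i => gradient (f i) ((run A ξ ζ t θ).x i) with hM
  have hM2 : MemLp M 2 P :=
    hXs.sub ((memLp_nodeAvg fun i => h.memLp_gradient ht i).const_smul (A.η t))
  have hMm : ∀ {m : MeasurableSpace Ω}, (∀ i, Measurable[m] fun θ => (run A ξ ζ t θ).x i) →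
      Measurable[m] M := fun hm =>
    ((measurable_nodeAvg hm).sub_const _).sub ((measurable_nodeAvg fun i =>
      (measurable_gradient (f i)).comp (hm i)).fun_const_smul _)
  have hsplit : ∀ θ, ‖nodeAvg (run A ξ ζ (t + 1) θ).x - xstar‖ ^ 2
      = ‖M θ‖ ^ 2 - 2 * A.η t * inner ℝ (M θ) (nodeAvg fun i => gradNoise f A ξ ζ t i θ)
        + A.η t ^ 2 * ‖nodeAvg fun i => gradNoise f A ξ ζ t i θ‖ ^ 2 := by
    intro θ
    have e : nodeAvg (run A ξ ζ (t + 1) θ).x - xstar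
        = M θ - A.η t • nodeAvg fun i => gradNoise f A ξ ζ t i θ := by
      rw [nodeAvg_run_succ A hW, hM]
      simp only [gradNoise]
      rw [nodeAvg_sub]
      module
    rw [e, norm_sub_sq_real, inner_smul_right, norm_smul, mul_pow, Real.norm_eq_abs, sq_abs]
    ring
  have hcross : ∫ θ, inner ℝ (M θ) (nodeAvg fun i => gradNoise f A ξ ζ t i θ) ∂P = 0 := by
    simp_rw [inner_nodeAvg]
    rw [integral_const_mul, integral_finsetSum _ fun i _ => integrable_inner_of_memLp hM2 (hN i),
      Finset.sum_eq_zero, mul_zero]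
    intro j _
    exact h.integral_inner_gradNoise t j (hMm (h.measurable_x t)) hM2
      (hMm fun i => h.measurable_x_other_data t i j)
  have hI1 := integrable_norm_sq hM2
  have hI2 := (integrable_inner_of_memLp hM2 hNa).const_mul (2 * A.η t)
  have hI3 := (integrable_norm_sq hNa).const_mul (A.η t ^ 2)
  simp_rw [hsplit]
  rw [integral_sub_add hI1 hI2 hI3, integral_const_mul, integral_const_mul, hcross]
  have hJ1 := (integrable_norm_sq hXs).const_mul (1 - A.η t * μ / 2)
  have hFs : Integrable (fun θ => globalObj f (nodeAvg (run A ξ ζ t θ).x) - globalObj f xstar) P :=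
    hF.sub (integrable_const _)
  have hJ2 := hFs.const_mul (A.η t)
  have hJ3 := ((integrable_dev hX).const_mul (n : ℝ)⁻¹).const_mul (A.η t * (2 * L + μ))
  have hdes : ∫ θ, ‖M θ‖ ^ 2 ∂P
      ≤ ∫ θ, ((1 - A.η t * μ / 2) * ‖nodeAvg (run A ξ ζ t θ).x - xstar‖ ^ 2
      - A.η t * (globalObj f (nodeAvg (run A ξ ζ t θ).x) - globalObj f xstar)
      + A.η t * (2 * L + μ) * ((n : ℝ)⁻¹ * dev (run A ξ ζ t θ).x)) ∂P :=
    integral_mono hI1 ((hJ1.sub hJ2).add hJ3) fun θ =>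
      norm_sub_nodeAvg_gradient_sq_le hn hμ hs hc hx hη hηL _
  have e : ∫ θ, ((1 - A.η t * μ / 2) * ‖nodeAvg (run A ξ ζ t θ).x - xstar‖ ^ 2
      - A.η t * (globalObj f (nodeAvg (run A ξ ζ t θ).x) - globalObj f xstar)
      + A.η t * (2 * L + μ) * ((n : ℝ)⁻¹ * dev (run A ξ ζ t θ).x)) ∂P
      = (1 - A.η t * μ / 2) * ∫ θ, ‖nodeAvg (run A ξ ζ t θ).x - xstar‖ ^ 2 ∂P
        - A.η t * (∫ θ, globalObj f (nodeAvg (run A ξ ζ t θ).x) ∂P - globalObj f xstar)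
        + A.η t * (2 * L + μ) * ((n : ℝ)⁻¹ * ∫ θ, dev (run A ξ ζ t θ).x ∂P) := by
    rw [integral_sub_add hJ1 hJ2 hJ3, integral_const_mul, integral_const_mul,
      integral_const_mul, integral_const_mul,
      integral_sub hF (integrable_const _)]
    simp
  rw [e] at hdes
  have hvar := mul_le_mul_of_nonneg_left (h.integral_norm_nodeAvg_gradNoise_sq_le hn t)
    (sq_nonneg (A.η t))
  linarith

end IsRun

end SPARQ

/-! ### The consensus error -/

namespace SPARQ

/-- The last synchronization index before `m`. -/
lemma exists_last_mem {I : Set ℕ} (h0 : 0 ∈ I) {m : ℕ} (hm : 0 < m) :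
    ∃ s ∈ I, s < m ∧ ∀ r ∈ I, ¬ (s < r ∧ r < m) := by
  induction m with
  | zero => omega
  | succ m ih =>
    by_cases h : m ∈ I
    · exact ⟨m, h, by omega, fun r _ => by omega⟩
    · have hm' : 0 < m := Nat.pos_of_ne_zero fun e => h (e ▸ h0)
      obtain ⟨s, hs, hsm, hr⟩ := ih hm'
      refine ⟨s, hs, by omega, fun r hrI hrm => ?_⟩
      have : r ≠ m := fun e => h (e ▸ hrI)
      exact hr r hrI ⟨hrm.1, by omega⟩

/-- Every time before the horizon lies in a round of length at most `H`. -/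
lemma exists_round {I : Set ℕ} {T H t : ℕ} (h0 : 0 ∈ I) (hI : GapLE I T H) (ht : t < T) :
    ∃ s ∈ I, s ≤ t ∧ t < s + H ∧ ∀ r ∈ I, ¬ (s < r ∧ r ≤ t) := by
  classical
  obtain ⟨s, hs, hst, hr⟩ := exists_last_mem h0 (Nat.succ_pos t)
  have hex : ∃ m, m ∈ insert T I ∧ t < m := ⟨T, Set.mem_insert _ _, ht⟩
  have hm := Nat.find_spec hex
  have hmT : Nat.find hex ≤ T := Nat.find_min' hex ⟨Set.mem_insert _ _, ht⟩
  have := hI s hs _ hm.1 (by omega) hmT fun r hrI hrm => by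
    by_cases hrt : r ≤ t
    · exact hr r hrI ⟨hrm.1, by omega⟩
    · exact Nat.find_min hex hrm.2 ⟨Set.mem_insert_of_mem _ hrI, by omega⟩
  exact ⟨s, hs, by omega, by omega, fun r hrI hrm => hr r hrI ⟨hrm.1, by omega⟩⟩

/-- The sum of the local steps of node `i` in the iterations from `s` to `m - 1`. -/
noncomputable def drift {n d : ℕ} {Ω Ξ Z : Type*} (A : Input n d Ξ Z)
    (ξ : ℕ → Fin n → Ω → Ξ) (ζ : ℕ → Fin n → Ω → Z) (s m : ℕ) (i : Fin n) (θ : Ω) : Vec d :=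
  ∑ u ∈ Finset.Ico s m, A.η u • stochGrad A ξ ζ u i θ

/-- Between synchronizations the nodes make local steps only, and the estimates do not change. -/
lemma run_of_no_sync {n d : ℕ} {Ω Ξ Z : Type*} (A : Input n d Ξ Z)
    (ξ : ℕ → Fin n → Ω → Ξ) (ζ : ℕ → Fin n → Ω → Z) {s t : ℕ} (hst : s ≤ t)
    (h : ∀ r ∈ A.I, ¬ (s < r ∧ r ≤ t)) (θ : Ω) :
    (run A ξ ζ t θ).x = (fun i => (run A ξ ζ s θ).x i + -drift A ξ ζ s t i θ) ∧
      (run A ξ ζ t θ).xhat = (run A ξ ζ s θ).xhat := by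
  induction t, hst using Nat.le_induction with
  | base => simp [drift]
  | succ t hst ih =>
    obtain ⟨ih1, ih2⟩ := ih fun r hr hrt => h r hr ⟨hrt.1, by omega⟩
    rw [run_succ_of_notMem A ξ ζ fun hI => h (t + 1) hI ⟨by omega, le_rfl⟩]
    refine ⟨?_, ih2⟩
    funext i
    change localStep A ξ ζ t i θ = _
    rw [localStep_eq, ih1]
    simp only [drift, Finset.sum_Ico_succ_top hst]
    abel

/-- The expected consensus error plus the expected error of the estimates. -/
noncomputable def energy {n d : ℕ} {Ω Ξ Z : Type*} [MeasurableSpace Ω] (P : Measure Ω)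
    (A : Input n d Ξ Z) (ξ : ℕ → Fin n → Ω → Ξ) (ζ : ℕ → Fin n → Ω → Z) (t : ℕ) : ℝ :=
  ∫ θ, dev (run A ξ ζ t θ).x ∂P
    + ∫ θ, ∑ i, ‖(run A ξ ζ t θ).x i - (run A ξ ζ t θ).xhat i‖ ^ 2 ∂P

namespace IsRun

variable {n d : ℕ} {Ω Ξ Z : Type*} [MeasurableSpace Ω] [MeasurableSpace Ξ]
    [MeasurableSpace Z] {P : Measure Ω} {D : Fin n → Measure Ξ} {ν : Measure Z}
    {f : Fin n → Vec d → ℝ} {G ω : ℝ} {σ : Fin n → ℝ} {T : ℕ} {A : Input n d Ξ Z}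
    {ξ : ℕ → Fin n → Ω → Ξ} {ζ : ℕ → Fin n → Ω → Z}

lemma memLp_drift (h : IsRun P D ν f G ω σ T A ξ ζ) {s m : ℕ} (hm : m ≤ T) (i : Fin n) :
    MemLp (drift A ξ ζ s m i) 2 P := by
  have : ∀ u ∈ Finset.Ico s m, MemLp (fun θ => A.η u • stochGrad A ξ ζ u i θ) 2 P :=
    fun u hu => (h.memLp_stochGrad
      (lt_of_lt_of_le (Finset.mem_Ico.1 hu).2 hm) i).1.const_smul (A.η u)
  exact memLp_finsetSum _ this

lemma integral_sum_norm_drift_sq_le (h : IsRun P D ν f G ω σ T A ξ ζ) {H s m : ℕ} (hm : m ≤ T)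
    (hH : m ≤ s + H) (hη0 : ∀ t, 0 ≤ A.η t) (hη : Antitone A.η) :
    ∫ θ, ∑ i, ‖drift A ξ ζ s m i θ‖ ^ 2 ∂P ≤ n * (H ^ 2 * G ^ 2 * A.η s ^ 2) := by
  have hlt : ∀ u ∈ Finset.Ico s m, u < T := fun u hu =>
    lt_of_lt_of_le (Finset.mem_Ico.1 hu).2 hm
  have hI : ∀ i, ∀ u ∈ Finset.Ico s m, Integrable (fun θ => ‖stochGrad A ξ ζ u i θ‖ ^ 2) P :=
    fun i u hu => integrable_norm_sq (h.memLp_stochGrad (hlt u hu) i).1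
  have hcard : ((Finset.Ico s m).card : ℝ) ≤ H := by
    rw [Nat.card_Ico]; exact_mod_cast (by omega : m - s ≤ H)
  rw [integral_finsetSum _ fun i _ => integrable_norm_sq (h.memLp_drift hm i)]
  have key : ∀ i, ∫ θ, ‖drift A ξ ζ s m i θ‖ ^ 2 ∂P ≤ H ^ 2 * G ^ 2 * A.η s ^ 2 := by
    intro i
    calc ∫ θ, ‖drift A ξ ζ s m i θ‖ ^ 2 ∂P
        ≤ ∫ θ, ((Finset.Ico s m).card : ℝ)
            * ∑ u ∈ Finset.Ico s m, A.η s ^ 2 * ‖stochGrad A ξ ζ u i θ‖ ^ 2 ∂P := by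
          refine integral_mono (integrable_norm_sq (h.memLp_drift hm i))
            ((integrable_finsetSum _ fun u hu => (hI i u hu).const_mul _).const_mul _)
            fun θ => ?_
          change ‖drift A ξ ζ s m i θ‖ ^ 2 ≤ ((Finset.Ico s m).card : ℝ)
            * ∑ u ∈ Finset.Ico s m, A.η s ^ 2 * ‖stochGrad A ξ ζ u i θ‖ ^ 2
          refine (pow_le_pow_left₀ (norm_nonneg _) (norm_sum_le _ _) 2).trans
            (sq_sum_le_card_mul_sum_sq.trans ?_)
          gcongr with u hu
          rw [norm_smul, mul_pow, Real.norm_eq_abs, sq_abs]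
          gcongr
          · exact hη0 u
          · exact hη (Finset.mem_Ico.1 hu).1
      _ ≤ (H : ℝ) * ∑ u ∈ Finset.Ico s m, A.η s ^ 2 * G ^ 2 := by
          rw [integral_const_mul, integral_finsetSum _ fun u hu => (hI i u hu).const_mul _]
          simp_rw [integral_const_mul]
          gcongr with u hu
          exact (h.memLp_stochGrad (hlt u hu) i).2
      _ ≤ (H : ℝ) * (H * (A.η s ^ 2 * G ^ 2)) := by
          rw [Finset.sum_const, nsmul_eq_mul]; gcongr
      _ = _ := by ring
  calc _ ≤ ∑ _i : Fin n, (H : ℝ) ^ 2 * G ^ 2 * A.η s ^ 2 := Finset.sum_le_sum fun i _ => key i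
    _ = _ := by simp

variable [IsProbabilityMeasure P]

/-- The consensus error at the end of the local steps of a round. -/
lemma integral_dev_add_drift_le (h : IsRun P D ν f G ω σ T A ξ ζ) (hn : 0 < n) {H s m : ℕ}
    (hsm : s ≤ m) (hm : m ≤ T)
    (hH : m ≤ s + H) (hη0 : ∀ t, 0 ≤ A.η t) (hη : Antitone A.η) {r : ℝ} (hr : 0 < r) :
    ∫ θ, dev (fun i => (run A ξ ζ s θ).x i + -drift A ξ ζ s m i θ) ∂P
      ≤ (1 + r) * ∫ θ, dev (run A ξ ζ s θ).x ∂P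
        + (1 + 1 / r) * (n * (H ^ 2 * G ^ 2 * A.η s ^ 2)) := by
  have hx := (h.memLp_state (hsm.trans hm)).1
  have hd := fun i => h.memLp_drift (s := s) hm i
  have i1 := (integrable_dev hx).const_mul (1 + r)
  have i2 := (integrable_sum_norm_sq Finset.univ hd).const_mul (1 + 1 / r)
  have h1 : ∫ θ, dev (fun i => (run A ξ ζ s θ).x i + -drift A ξ ζ s m i θ) ∂P
      ≤ ∫ θ, ((1 + r) * dev (run A ξ ζ s θ).x
        + (1 + 1 / r) * ∑ i, ‖drift A ξ ζ s m i θ‖ ^ 2) ∂P := by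
    refine integral_mono (integrable_dev fun i => (hx i).add (hd i).neg) (i1.add i2) fun θ => ?_
    have := dev_young hn hr (run A ξ ζ s θ).x fun i => -drift A ξ ζ s m i θ
    simpa using this
  rw [integral_add i1 i2, integral_const_mul, integral_const_mul] at h1
  refine h1.trans ?_
  gcongr
  exact h.integral_sum_norm_drift_sq_le hm hH hη0 hη

/-- The error of the estimates at the end of the local steps of a round. -/
lemma integral_estimate_add_drift_le (h : IsRun P D ν f G ω σ T A ξ ζ) {H s m : ℕ}
    (hsm : s ≤ m) (hm : m ≤ T)
    (hH : m ≤ s + H) (hη0 : ∀ t, 0 ≤ A.η t) (hη : Antitone A.η) {r : ℝ} (hr : 0 < r) :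
    ∫ θ, ∑ i, ‖(run A ξ ζ s θ).x i + -drift A ξ ζ s m i θ - (run A ξ ζ s θ).xhat i‖ ^ 2 ∂P
      ≤ (1 + r) * ∫ θ, ∑ i, ‖(run A ξ ζ s θ).x i - (run A ξ ζ s θ).xhat i‖ ^ 2 ∂P
        + (1 + 1 / r) * (n * (H ^ 2 * G ^ 2 * A.η s ^ 2)) := by
  obtain ⟨hx, hh⟩ := h.memLp_state (hsm.trans hm)
  have hd := fun i => h.memLp_drift (s := s) hm i
  have i1 := (integrable_sum_norm_sq Finset.univ fun i => (hx i).sub (hh i)).const_mul (1 + r)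
  have i2 := (integrable_sum_norm_sq Finset.univ hd).const_mul (1 + 1 / r)
  have h1 : ∫ θ, ∑ i, ‖(run A ξ ζ s θ).x i + -drift A ξ ζ s m i θ - (run A ξ ζ s θ).xhat i‖ ^ 2 ∂P
      ≤ ∫ θ, ((1 + r) * ∑ i, ‖(run A ξ ζ s θ).x i - (run A ξ ζ s θ).xhat i‖ ^ 2
        + (1 + 1 / r) * ∑ i, ‖drift A ξ ζ s m i θ‖ ^ 2) ∂P := by
    refine integral_mono (integrable_sum_norm_sq Finset.univ fun i =>
      ((hx i).add (hd i).neg).sub (hh i)) (i1.add i2) fun θ => ?_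
    have := sum_norm_add_sq_le_young hr Finset.univ
      (fun i => (run A ξ ζ s θ).x i - (run A ξ ζ s θ).xhat i) fun i => -drift A ξ ζ s m i θ
    simpa [add_sub_right_comm] using this
  have e := integral_add i1 i2
  simp only [Pi.sub_apply] at e
  rw [e, integral_const_mul, integral_const_mul] at h1
  refine h1.trans ?_
  gcongr
  exact h.integral_sum_norm_drift_sq_le hm hH hη0 hη

/-- The energy contracts from one synchronization to the next, up to the drift of the local steps
and the triggering threshold. -/
lemma energy_round_le (h : IsRun P D ν f G ω σ T A ξ ζ) (hn : 0 < n)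
    (hW : IsDoublyStochasticSymm A.W) (hgap : absLambdaTwo A.W < 1)
    (hγ : A.γ = gammaStar A.W ω) (hη0 : ∀ t, 0 ≤ A.η t) (hη : Antitone A.η)
    {H s t : ℕ} (hst : s ≤ t) (ht : t + 1 ∈ A.I) (htT : t + 1 ≤ T) (hH : t + 1 ≤ s + H)
    (hr : ∀ r ∈ A.I, ¬ (s < r ∧ r ≤ t)) :
    energy P A ξ ζ (t + 1) ≤ (1 - 2 * pRate A.W ω) * energy P A ξ ζ s
      + 1 / pRate A.W ω * (n * (H ^ 2 * G ^ 2 * A.η s ^ 2))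
      + 2 * (n * (ω * (A.c t * A.η t ^ 2))) := by
  obtain ⟨hp0, hp1⟩ := pRate_pos hn hW hgap h.ω_pos h.ω_le
  obtain ⟨κ, hκ0, hκ2, hκω, hκ⟩ := exists_gossip_contraction hn hW hgap h.ω_pos h.ω_le d
  set p := pRate A.W ω with hp
  have hlt : t < T := by omega
  have hL := fun i => h.memLp_localStep hlt i
  have hh := (h.memLp_state hlt.le).2
  have hLh : ∀ i, MemLp (fun θ => localStep A ξ ζ t i θ - (run A ξ ζ t θ).xhat i) 2 P :=
    fun i => (hL i).sub (hh i)
  have hE := fun i => h.memLp_estimate_error t i (hLh i)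
  have hLs : ∀ θ i, localStep A ξ ζ t i θ = (run A ξ ζ s θ).x i + -drift A ξ ζ s (t + 1) i θ := by
    intro θ i
    rw [localStep_eq, (run_of_no_sync A ξ ζ hst hr θ).1]
    simp only [drift, Finset.sum_Ico_succ_top hst]
    abel
  have hhs : ∀ θ i, (run A ξ ζ t θ).xhat i = (run A ξ ζ s θ).xhat i := fun θ i => by
    rw [(run_of_no_sync A ξ ζ hst hr θ).2]
  -- the gossip step
  have h1 : energy P A ξ ζ (t + 1) ≤ (1 - 4 * p) * ∫ θ, dev (fun i => localStep A ξ ζ t i θ) ∂P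
      + κ * ∑ i, ∫ θ, ‖localStep A ξ ζ t i θ - newEstimate A ξ ζ t i θ‖ ^ 2 ∂P := by
    obtain ⟨hx', hh'⟩ := h.memLp_state htT
    have i1 := (integrable_dev hL).const_mul (1 - 4 * p)
    have i2 := (integrable_sum_norm_sq Finset.univ fun i => (hE i).1).const_mul κ
    have i3 := integrable_dev hx'
    have i4 := integrable_sum_norm_sq Finset.univ fun i => (hx' i).sub (hh' i)
    simp only [Pi.sub_apply] at i4
    rw [energy, ← integral_add i3 i4, ← integral_finsetSum _ fun i _ => integrable_norm_sq (hE i).1,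
      ← integral_const_mul, ← integral_const_mul, ← integral_add i1 i2]
    refine integral_mono (i3.add i4) (i1.add i2) fun θ => ?_
    simp only [run_succ_of_mem A ξ ζ ht, hγ]
    exact hκ (fun i => localStep A ξ ζ t i θ) fun i => newEstimate A ξ ζ t i θ
  -- the messages
  have h2 : ∑ i, ∫ θ, ‖localStep A ξ ζ t i θ - newEstimate A ξ ζ t i θ‖ ^ 2 ∂P
      ≤ (1 - ω) * ∫ θ, ∑ i, ‖localStep A ξ ζ t i θ - (run A ξ ζ t θ).xhat i‖ ^ 2 ∂P
        + n * (ω * (A.c t * A.η t ^ 2)) := by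
    rw [integral_finsetSum _ fun i _ => integrable_norm_sq (hLh i), Finset.mul_sum]
    calc _ ≤ _ := Finset.sum_le_sum fun i _ => (hE i).2
      _ = _ := by rw [Finset.sum_add_distrib]; simp
  -- the local steps; with `r = 2 p` Young's inequality uses up half of the contraction `1 - 4 p`
  have h3 := h.integral_dev_add_drift_le hn (by omega : s ≤ t + 1) htT hH hη0 hη
    (r := 2 * p) (by linarith)
  have h4 := h.integral_estimate_add_drift_le (by omega : s ≤ t + 1) htT hH hη0 hη
    (r := 2 * p) (by linarith)
  simp_rw [hLs, hhs] at h2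
  simp_rw [hLs] at h1
  set D₁ := ∫ θ, dev (fun i => (run A ξ ζ s θ).x i + -drift A ξ ζ s (t + 1) i θ) ∂P
  set D₂ := ∫ θ, ∑ i, ‖(run A ξ ζ s θ).x i + -drift A ξ ζ s (t + 1) i θ
    - (run A ξ ζ s θ).xhat i‖ ^ 2 ∂P with hD₂
  have hD₂0 : 0 ≤ D₂ := integral_nonneg fun θ => Finset.sum_nonneg fun _ _ => sq_nonneg _
  set B := (n : ℝ) * (H ^ 2 * G ^ 2 * A.η s ^ 2)
  set Q := (n : ℝ) * (ω * (A.c t * A.η t ^ 2))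
  have hB : 0 ≤ B := by positivity
  have hQ : 0 ≤ Q := by have := h.c_nonneg t; have := h.ω_pos; positivity
  have hEs : 0 ≤ energy P A ξ ζ s :=
    add_nonneg (integral_nonneg fun θ => dev_nonneg _)
      (integral_nonneg fun θ => Finset.sum_nonneg fun _ _ => sq_nonneg _)
  have h5 : D₁ + D₂ ≤ (1 + 2 * p) * energy P A ξ ζ s + 2 * ((1 + 1 / (2 * p)) * B) := by
    rw [energy]; linarith
  have h6 : energy P A ξ ζ (t + 1) ≤ (1 - 4 * p) * (D₁ + D₂) + 2 * Q := by
    have := mul_le_mul_of_nonneg_left h2 hκ0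
    have := mul_le_mul_of_nonneg_right hκω hD₂0
    have := mul_le_mul_of_nonneg_right hκ2 hQ
    linarith
  have h7 := mul_le_mul_of_nonneg_left h5 (by linarith : 0 ≤ 1 - 4 * p)
  have h8 : (1 - 4 * p) * (2 * ((1 + 1 / (2 * p)) * B)) ≤ 1 / p * B := by
    have : (1 - 4 * p) * (2 * (1 + 1 / (2 * p))) ≤ 1 / p := by
      rw [le_div_iff₀ hp0]
      field_simp
      nlinarith
    calc _ = (1 - 4 * p) * (2 * (1 + 1 / (2 * p))) * B := by ring
      _ ≤ _ := mul_le_mul_of_nonneg_right this hB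
  have h9 : (1 - 4 * p) * ((1 + 2 * p) * energy P A ξ ζ s) ≤ (1 - 2 * p) * energy P A ξ ζ s := by
    nlinarith [mul_nonneg hp0.le hEs, mul_nonneg (mul_nonneg hp0.le hp0.le) hEs]
  linarith

end IsRun

/-- Within a round the squared learning rate decreases at most by the factor `1 + p / 2`, as
`η s / η m ≤ 1 + H / a ≤ 1 + p / 5`. -/
lemma learningRate_sq_le {μ a p : ℝ} {H s m : ℕ} {η : ℕ → ℝ} (hμ : 0 < μ)
    (hp : 0 < p) (hp1 : p ≤ 1 / 192) (ha0 : 0 < a) (ha : 5 * H / p ≤ a)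
    (hη : ∀ t : ℕ, η t = 8 / (μ * (a + t))) (hH : m ≤ s + H) :
    η s ^ 2 ≤ (1 + p / 2) * η m ^ 2 := by
  have hs : (0 : ℝ) ≤ s := Nat.cast_nonneg s
  have hm : (0 : ℝ) ≤ m := Nat.cast_nonneg m
  have hH' : (m : ℝ) ≤ s + H := by exact_mod_cast hH
  rw [div_le_iff₀ hp] at ha
  have h1 : η s ≤ (1 + p / 5) * η m := by
    rw [hη, hη, ← mul_div_assoc, div_le_div_iff₀ (by positivity) (by positivity)]
    have : a + m ≤ (1 + p / 5) * (a + s) := by nlinarith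
    nlinarith
  have h0 : 0 ≤ η s := by rw [hη]; positivity
  have h2 := pow_le_pow_left₀ h0 h1 2
  rw [mul_pow] at h2
  refine h2.trans (mul_le_mul_of_nonneg_right ?_ (sq_nonneg _))
  nlinarith

namespace IsRun

variable {n d : ℕ} {Ω Ξ Z : Type*} [MeasurableSpace Ω] [MeasurableSpace Ξ]
    [MeasurableSpace Z] {P : Measure Ω} {D : Fin n → Measure Ξ} {ν : Measure Z}
    {f : Fin n → Vec d → ℝ} {G ω : ℝ} {σ : Fin n → ℝ} {T : ℕ} {A : Input n d Ξ Z}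
    {ξ : ℕ → Fin n → Ω → Ξ} {ζ : ℕ → Fin n → Ω → Z} [IsProbabilityMeasure P]

/-- The energy at the synchronization times is of the order of the squared learning rate. -/
lemma energy_le (h : IsRun P D ν f G ω σ T A ξ ζ) (hn : 0 < n)
    (hW : IsDoublyStochasticSymm A.W) (hgap : absLambdaTwo A.W < 1)
    (hγ : A.γ = gammaStar A.W ω) {μ a : ℝ} {H : ℕ} (hμ : 0 < μ) (ha0 : 0 < a)
    (ha : 5 * H / pRate A.W ω ≤ a) (hη : ∀ t : ℕ, A.η t = 8 / (μ * (a + t)))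
    (hη0 : ∀ t, 0 ≤ A.η t) (hηa : Antitone A.η) (hc : Monotone A.c)
    (h0 : 0 ∈ A.I) (hI : GapLE A.I T H) {m : ℕ} (hm : m ∈ A.I) (hmT : m ≤ T) :
    energy P A ξ ζ m ≤ n * A.η m ^ 2 *
      (H ^ 2 * G ^ 2 / pRate A.W ω ^ 2 + 2 * ω * A.c m / pRate A.W ω) := by
  obtain ⟨hp0, hp1⟩ := pRate_pos hn hW hgap h.ω_pos h.ω_le
  have hω := h.ω_pos
  induction m using Nat.strong_induction_on with
  | _ m ih =>
    rcases Nat.eq_zero_or_pos m with rfl | hm0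
    · have e : energy P A ξ ζ 0 = 0 := by
        have hn' : (n : ℝ) ≠ 0 := by positivity
        have hd : dev (fun _ : Fin n => A.x0) = 0 := by
          simp [dev, nodeAvg, ← Nat.cast_smul_eq_nsmul ℝ, smul_smul, hn']
        simp [energy, run, hd]
      rw [e]
      have := h.c_nonneg 0
      positivity
    · obtain ⟨s, hs, hsm, hr⟩ := exists_last_mem h0 hm0
      obtain ⟨t, rfl⟩ : ∃ t, m = t + 1 := ⟨m - 1, by omega⟩
      have hH : t + 1 ≤ s + H := hI s hs _ (Set.mem_insert_of_mem _ hm) hsm hmT hr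
      have h1 := h.energy_round_le hn hW hgap hγ hη0 hηa (by omega : s ≤ t) hm hmT hH
        fun r hrI hrm => hr r hrI ⟨hrm.1, by omega⟩
      have h2 := ih s hsm hs (by omega)
      have h3 := learningRate_sq_le hμ hp0 hp1 ha0 ha hη hH
      have h4 := learningRate_sq_le hμ hp0 hp1 ha0 ha hη (by omega : t + 1 ≤ t + H)
      have hcs : A.c s ≤ A.c (t + 1) := hc hsm.le
      have hct : A.c t ≤ A.c (t + 1) := hc (by omega)
      have hc0 := h.c_nonneg s
      have hc0' := h.c_nonneg t
      have hy := sq_nonneg (A.η (t + 1))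
      have hx := sq_nonneg (A.η s)
      have hz := sq_nonneg (A.η t)
      generalize A.η (t + 1) ^ 2 = y at *
      generalize A.η s ^ 2 = x at *
      generalize A.η t ^ 2 = z at *
      generalize A.c (t + 1) = c at *
      set p := pRate A.W ω with hp
      set K := H ^ 2 * G ^ 2 / p ^ 2 with hK
      have hK0 : 0 ≤ K := by positivity
      set N := (n : ℝ) * y with hN
      have hN0 : 0 ≤ N := by positivity
      have hc1 : 0 ≤ c := hc0.trans hcs
      have hC0 : 0 ≤ 2 * ω * c / p := by positivity
      have b1 : energy P A ξ ζ s ≤ (1 + p / 2) * (N * (K + 2 * ω * c / p)) := by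
        calc _ ≤ _ := h2
          _ ≤ n * ((1 + p / 2) * y) * (K + 2 * ω * c / p) := by gcongr
          _ = _ := by rw [hN]; ring
      have b2 : 1 / p * (n * (H ^ 2 * G ^ 2 * x)) ≤ p * (1 + p / 2) * (N * K) := by
        calc _ ≤ 1 / p * (n * (H ^ 2 * G ^ 2 * ((1 + p / 2) * y))) := by gcongr
          _ = _ := by rw [hN, hK]; field_simp
      have b3 : 2 * (n * (ω * (A.c t * z))) ≤ p * (1 + p / 2) * (N * (2 * ω * c / p)) := by
        calc _ ≤ 2 * (n * (ω * (c * ((1 + p / 2) * y)))) := by gcongr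
          _ = _ := by rw [hN]; field_simp
      have b4 := mul_le_mul_of_nonneg_left b1 (by linarith : 0 ≤ 1 - 2 * p)
      have hNK := mul_nonneg hN0 hK0
      have hNC := mul_nonneg hN0 hC0
      -- the contraction factor absorbs the growth of the learning rates and the new errors
      have b5 : (1 - 2 * p) * (1 + p / 2) + p * (1 + p / 2) ≤ 1 := by nlinarith
      have b6 := mul_le_mul_of_nonneg_right b5 (add_nonneg hNK hNC)
      nlinarith

/-- The consensus error at any time before the horizon is of the order of the squared learning
rate. -/
lemma integral_dev_le (h : IsRun P D ν f G ω σ T A ξ ζ) (hn : 0 < n)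
    (hW : IsDoublyStochasticSymm A.W) (hgap : absLambdaTwo A.W < 1)
    (hγ : A.γ = gammaStar A.W ω) {μ a : ℝ} {H : ℕ} (hμ : 0 < μ) (ha0 : 0 < a)
    (ha : 5 * H / pRate A.W ω ≤ a) (hη : ∀ t : ℕ, A.η t = 8 / (μ * (a + t)))
    (hη0 : ∀ t, 0 ≤ A.η t) (hηa : Antitone A.η) (hc : Monotone A.c)
    (h0 : 0 ∈ A.I) (hI : GapLE A.I T H) {t : ℕ} (ht : t < T) :
    (n : ℝ)⁻¹ * ∫ θ, dev (run A ξ ζ t θ).x ∂P ≤ A.η t ^ 2 *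
      (1280 * (H ^ 2 * G ^ 2 / pRate A.W ω ^ 2) + 100 * ω / pRate A.W ω * A.c t) := by
  obtain ⟨hp0, hp1⟩ := pRate_pos hn hW hgap h.ω_pos h.ω_le
  have hω := h.ω_pos
  have hn' : (0 : ℝ) < n := by exact_mod_cast hn
  obtain ⟨s, hs, hst, hH, hr⟩ := exists_round h0 hI ht
  have h1 := h.integral_dev_add_drift_le hn hst ht.le hH.le hη0 hηa one_pos
  have h2 := h.energy_le hn hW hgap hγ hμ ha0 ha hη hη0 hηa hc h0 hI hs (hst.trans ht.le)
  have h3 := learningRate_sq_le hμ hp0 hp1 ha0 ha hη hH.le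
  have h4 : ∫ θ, dev (run A ξ ζ s θ).x ∂P ≤ energy P A ξ ζ s :=
    le_add_of_nonneg_right (integral_nonneg fun θ => Finset.sum_nonneg fun _ _ => sq_nonneg _)
  simp_rw [← (run_of_no_sync A ξ ζ hst hr _).1] at h1
  have hcs : A.c s ≤ A.c t := hc hst
  have hc0 := h.c_nonneg s
  set p := pRate A.W ω with hp
  have hx0 := sq_nonneg (A.η s)
  have h5 : A.η s ^ 2 ≤ 2 * A.η t ^ 2 := by nlinarith [sq_nonneg (A.η t)]
  have hK : H ^ 2 * G ^ 2 ≤ H ^ 2 * G ^ 2 / p ^ 2 := by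
    rw [le_div_iff₀ (by positivity)]
    have : p ^ 2 ≤ 1 := by nlinarith
    have : 0 ≤ (H : ℝ) ^ 2 * G ^ 2 := by positivity
    nlinarith
  set K := H ^ 2 * G ^ 2 / p ^ 2
  have hK0 : 0 ≤ K := by positivity
  rw [inv_mul_le_iff₀ hn']
  calc _ ≤ _ := h1
    _ ≤ (1 + 1) * (n * A.η s ^ 2 * (K + 2 * ω * A.c s / p))
        + (1 + 1 / 1) * (n * (K * A.η s ^ 2)) := by
        have := h4.trans h2
        gcongr
    _ = n * (A.η s ^ 2 * (4 * K + 4 * (ω / p * A.c s))) := by ring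
    _ ≤ n * (2 * A.η t ^ 2 * (4 * K + 4 * (ω / p * A.c t))) := by gcongr
    _ = n * (A.η t ^ 2 * (8 * K + 8 * (ω / p * A.c t))) := by ring
    _ ≤ n * (A.η t ^ 2 * (1280 * K + 100 * (ω / p * A.c t))) := by
        have : 0 ≤ A.c t := hc0.trans hcs
        gcongr <;> norm_num
    _ = _ := by ring

end IsRun

end SPARQ

/-! ### The convergence rate -/

namespace SPARQ

lemma nodeAvg_const {n d : ℕ} (hn : 0 < n) (x : Vec d) : (nodeAvg fun _ : Fin n => x) = x := by
  have hn' : (n : ℝ) ≠ 0 := by positivity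
  simp [nodeAvg, ← Nat.cast_smul_eq_nsmul ℝ, smul_smul, hn']

/-- The objective is integrable along a square integrable random point: it is bounded below by its
minimum and above by a quadratic function. -/
lemma integrable_globalObj {n d : ℕ} {Ω : Type*} [MeasurableSpace Ω] {P : Measure Ω}
    [IsFiniteMeasure P] (hn : 0 < n) {L : ℝ} {f : Fin n → Vec d → ℝ}
    (hs : ∀ i, IsLSmooth L (f i)) {xstar : Vec d} (hx : ∀ x, globalObj f xstar ≤ globalObj f x)
    {V : Ω → Vec d} (hV : MemLp V 2 P) : Integrable (fun θ => globalObj f (V θ)) P := by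
  have hcont : Continuous (globalObj f) :=
    continuous_const.mul (continuous_finsetSum _ fun i _ => (hs i).2.1.continuous)
  have hVs : MemLp (fun θ => V θ - xstar) 2 P := hV.sub (memLp_const _)
  set g := nodeAvg fun i => gradient (f i) xstar
  have hI : Integrable (fun θ => |globalObj f xstar| + |inner ℝ g (V θ - xstar)|
      + L / 2 * ‖V θ - xstar‖ ^ 2) P :=
    ((integrable_const _).add (integrable_inner_of_memLp (memLp_const g) hVs).abs).add
      ((integrable_norm_sq hVs).const_mul _)
  refine hI.mono' (hcont.comp_aestronglyMeasurable hV.1) (Filter.Eventually.of_forall fun θ => ?_)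
  have h1 := globalObj_smooth hn hs xstar (V θ)
  have h2 := hx (V θ)
  have h3 : 0 ≤ L / 2 * ‖V θ - xstar‖ ^ 2 :=
    mul_nonneg (div_nonneg (hs ⟨0, hn⟩).1 zero_le_two) (sq_nonneg _)
  rw [Real.norm_eq_abs, abs_le]
  constructor
  · linarith [neg_abs_le (globalObj f xstar), abs_nonneg (inner ℝ g (V θ - xstar))]
  · linarith [le_abs_self (globalObj f xstar), le_abs_self (inner ℝ g (V θ - xstar))]

namespace IsRun

variable {n d : ℕ} {Ω Ξ Z : Type*} [MeasurableSpace Ω] [MeasurableSpace Ξ]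
    [MeasurableSpace Z] {P : Measure Ω} {D : Fin n → Measure Ξ} {ν : Measure Z}
    {f : Fin n → Vec d → ℝ} {G ω : ℝ} {σ : Fin n → ℝ} {T : ℕ} {A : Input n d Ξ Z}
    {ξ : ℕ → Fin n → Ω → Ξ} {ζ : ℕ → Fin n → Ω → Z} [IsProbabilityMeasure P]

/-- At the deterministic initial point, the second moment of the stochastic gradient is the squared
norm of the gradient plus the variance. -/
lemma norm_gradient_x0_sq_le (h : IsRun P D ν f G ω σ T A ξ ζ) (hT : 0 < T) (i : Fin n) :
    ‖gradient (f i) A.x0‖ ^ 2 ≤ G ^ 2 := by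
  have h1 := (h.memLp_stochGrad hT i).2
  have hN := (h.memLp_gradNoise 0 i).1
  have h2 := h.integral_inner_gradNoise 0 i (U := fun _ => gradient (f i) A.x0)
    measurable_const (memLp_const _) measurable_const
  have e : ∀ θ, ‖stochGrad A ξ ζ 0 i θ‖ ^ 2 = ‖gradient (f i) A.x0‖ ^ 2
      + 2 * inner ℝ (gradient (f i) A.x0) (gradNoise f A ξ ζ 0 i θ)
      + ‖gradNoise f A ξ ζ 0 i θ‖ ^ 2 := fun θ => by
    rw [← norm_add_sq_real]
    congr 2
    simp [gradNoise, run]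
  have i2 := (integrable_inner_of_memLp (memLp_const (gradient (f i) A.x0)) hN).const_mul 2
  have i3 : Integrable (fun θ => ‖gradient (f i) A.x0‖ ^ 2
      + 2 * inner ℝ (gradient (f i) A.x0) (gradNoise f A ξ ζ 0 i θ)) P :=
    (integrable_const _).add i2
  simp_rw [e] at h1
  rw [integral_add i3 (integrable_norm_sq hN), integral_add (integrable_const _) i2,
    integral_const_mul, h2] at h1
  have h3 : 0 ≤ ∫ θ, ‖gradNoise f A ξ ζ 0 i θ‖ ^ 2 ∂P := integral_nonneg fun θ => sq_nonneg _
  simp only [integral_const, probReal_univ, one_smul] at h1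
  linarith

/-- By strong convexity, the bound on the stochastic gradients at the initial point bounds the
distance of the initial point to the minimizer. -/
lemma norm_x0_sub_sq_le (h : IsRun P D ν f G ω σ T A ξ ζ) (hn : 0 < n) (hT : 0 < T) {μ : ℝ}
    (hμ : 0 < μ) (hc : ∀ i, IsStronglyConvex μ (f i)) {xstar : Vec d}
    (hx : ∀ x, globalObj f xstar ≤ globalObj f x) :
    μ ^ 2 * ‖A.x0 - xstar‖ ^ 2 ≤ 4 * G ^ 2 := by
  have hn' : (0 : ℝ) < n := by exact_mod_cast hn
  have h1 := globalObj_stronglyConvex hn hc A.x0 xstar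
  have h2 := hx A.x0
  set g := nodeAvg fun i => gradient (f i) A.x0 with hg
  have h3 : ‖g‖ ^ 2 ≤ G ^ 2 := by
    refine (norm_nodeAvg_sq_le hn _).trans ?_
    calc _ ≤ (n : ℝ)⁻¹ * ∑ _i : Fin n, G ^ 2 := by
          exact mul_le_mul_of_nonneg_left (Finset.sum_le_sum fun i _ =>
            h.norm_gradient_x0_sq_le hT i) (inv_nonneg.2 hn'.le)
      _ = _ := by simp; field_simp
  have h4 := neg_le_of_abs_le (abs_real_inner_le_norm g (xstar - A.x0))
  rw [norm_sub_rev xstar] at h1 h4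
  generalize ‖A.x0 - xstar‖ = r at *
  have h5 : μ * (μ / 2 * r ^ 2) ≤ μ * (‖g‖ * r) := mul_le_mul_of_nonneg_left (by linarith) hμ.le
  nlinarith [sq_nonneg (2 * ‖g‖ - μ * r)]

end IsRun

/-- The asymptotic form of the rate: for `T ≥ a³` the term with the initial distance is dominated
by the term with the second moment bound `G²`, and `S_T ≥ T³ / 3`. -/
lemma rate_le_of_cube_le {μ L G ω c₀ ε a p a₀ v S N h T : ℝ} (hμ : 0 < μ) (hL : 0 ≤ L)
    (hω : 0 < ω) (hc₀ : 0 ≤ c₀) (hε : 0 < ε) (hε1 : ε < 1) (ha : 1 ≤ a) (hp : 0 < p)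
    (hp1 : p ≤ 1) (ha₀ : μ ^ 2 * a₀ ≤ 4 * G ^ 2) (ha₀0 : 0 ≤ a₀) (hv : 0 ≤ v) (hN : 0 < N)
    (hh : 1 ≤ h) (hT : 1 ≤ T) (hS : T ^ 3 / 3 ≤ S) (haT : a ^ 3 ≤ T) :
    μ * a ^ 3 / (8 * S) * a₀ + 4 * T * (T + 2 * a) / (μ * S) * (v / N)
        + 512 * 160 * ((2 * L + μ) * G ^ 2 * h ^ 2 * T / (μ ^ 2 * p ^ 2 * S))
        + 6400 / (2 - ε) * (c₀ * ω * (2 * L + μ) * T ^ (2 - ε) / (μ ^ 2 * p * S))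
      ≤ 36 * (v / (μ * N * T)) + 250000 * ((2 * L + μ) * G ^ 2 * h ^ 2 / (μ ^ 2 * p ^ 2 * T ^ 2))
        + 19200 * (c₀ * ω * (2 * L + μ) / (μ ^ 2 * p * T ^ (1 + ε))) := by
  have hT0 : 0 < T := by linarith
  have hS0 : 0 < S := lt_of_lt_of_le (by positivity) hS
  have haT' : a ≤ T := le_trans (le_self_pow₀ ha three_ne_zero) haT
  have hSi : 1 / S ≤ 3 / T ^ 3 := by
    rw [div_le_div_iff₀ hS0 (by positivity)]; linarith
  set E := (2 * L + μ) * G ^ 2 * h ^ 2 / (μ ^ 2 * p ^ 2 * T ^ 2) with hE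
  have e3 : 0 ≤ E := by rw [hE]; positivity
  have h1 : μ * a ^ 3 / (8 * S) * a₀ ≤ 4000 * E := by
    have e1 : μ * a ^ 3 / (8 * S) * a₀ ≤ 3 / 2 * (μ * G ^ 2 / (μ ^ 2 * T ^ 2)) := by
      calc μ * a ^ 3 / (8 * S) * a₀ = a ^ 3 * (μ ^ 2 * a₀) / (8 * μ) * (1 / S) := by
            field_simp
        _ ≤ T * (4 * G ^ 2) / (8 * μ) * (3 / T ^ 3) := by gcongr
        _ = _ := by field_simp; ring
    have e2 : μ * G ^ 2 / (μ ^ 2 * T ^ 2) ≤ E := by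
      rw [hE]
      have b1 : μ * G ^ 2 ≤ (2 * L + μ) * G ^ 2 * h ^ 2 := by
        calc μ * G ^ 2 = μ * G ^ 2 * 1 ^ 2 := by ring
          _ ≤ _ := by gcongr; linarith
      have b2 : μ ^ 2 * p ^ 2 * T ^ 2 ≤ μ ^ 2 * T ^ 2 := by
        calc μ ^ 2 * p ^ 2 * T ^ 2 ≤ μ ^ 2 * 1 ^ 2 * T ^ 2 := by gcongr
          _ = _ := by ring
      gcongr
    linarith
  have h2 : 4 * T * (T + 2 * a) / (μ * S) * (v / N) ≤ 36 * (v / (μ * N * T)) := by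
    calc 4 * T * (T + 2 * a) / (μ * S) * (v / N)
        = 4 * T * (T + 2 * a) / μ * (1 / S) * (v / N) := by field_simp
      _ ≤ 4 * T * (T + 2 * T) / μ * (3 / T ^ 3) * (v / N) := by gcongr
      _ = _ := by field_simp; ring
  have h3 : (2 * L + μ) * G ^ 2 * h ^ 2 * T / (μ ^ 2 * p ^ 2 * S) ≤ 3 * E := by
    calc (2 * L + μ) * G ^ 2 * h ^ 2 * T / (μ ^ 2 * p ^ 2 * S)
        = (2 * L + μ) * G ^ 2 * h ^ 2 * T / (μ ^ 2 * p ^ 2) * (1 / S) := by field_simp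
      _ ≤ (2 * L + μ) * G ^ 2 * h ^ 2 * T / (μ ^ 2 * p ^ 2) * (3 / T ^ 3) := by gcongr
      _ = _ := by rw [hE]; field_simp
  have h4 : 6400 / (2 - ε) * (c₀ * ω * (2 * L + μ) * T ^ (2 - ε) / (μ ^ 2 * p * S))
      ≤ 19200 * (c₀ * ω * (2 * L + μ) / (μ ^ 2 * p * T ^ (1 + ε))) := by
    have e1 : (6400 : ℝ) / (2 - ε) ≤ 6400 := div_le_self (by norm_num) (by linarith)
    have e2 : T ^ 3 = T ^ (2 - ε) * T ^ (1 + ε) := by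
      rw [← Real.rpow_add hT0, ← Real.rpow_natCast]; norm_num
    have e3 : 0 < T ^ (2 - ε) := Real.rpow_pos_of_pos hT0 _
    have e4 : 0 < T ^ (1 + ε) := Real.rpow_pos_of_pos hT0 _
    calc _ ≤ 6400 * (c₀ * ω * (2 * L + μ) * T ^ (2 - ε) / (μ ^ 2 * p * S)) := by gcongr
      _ = 6400 * (c₀ * ω * (2 * L + μ) * T ^ (2 - ε) / (μ ^ 2 * p) * (1 / S)) := by field_simp
      _ ≤ 6400 * (c₀ * ω * (2 * L + μ) * T ^ (2 - ε) / (μ ^ 2 * p) * (3 / T ^ 3)) := by gcongr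
      _ = _ := by rw [e2]; field_simp; ring
  linarith

end SPARQ

theorem mainTheorem1 {n d : ℕ} {Ω Ξ Z : Type*}
    [MeasurableSpace Ω] [MeasurableSpace Ξ] [MeasurableSpace Z]
    (hn : 0 < n)
    (P : Measure Ω) [IsProbabilityMeasure P]
    (D : Fin n → Measure Ξ) (ν : Measure Z)
    (f : Fin n → SPARQ.Vec d → ℝ) (xstar : SPARQ.Vec d)
    (μ L G ω c₀ ε a : ℝ) (σ : Fin n → ℝ) (H T : ℕ)
    (A : SPARQ.Input n d Ξ Z)
    (ξ : ℕ → Fin n → Ω → Ξ) (ζ : ℕ → Fin n → Ω → Z)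
    (hT : 1 ≤ T)
    -- objective
    (hμ : 0 < μ)
    (hsmooth : ∀ i, SPARQ.IsLSmooth L (f i))
    (hconv : ∀ i, SPARQ.IsStronglyConvex μ (f i))
    (hxstar : ∀ x, SPARQ.globalObj f xstar ≤ SPARQ.globalObj f x)
    -- randomness
    (hsamp : SPARQ.IsSampling P D ν ξ ζ)
    -- stochastic gradients: unbiased, bounded variance, second moment bounded along the run
    (hgmeas : ∀ i, Measurable (Function.uncurry (A.gradF i)))
    (hunbiased : ∀ i x, ∫ s, A.gradF i x s ∂(D i) = gradient (f i) x)
    (hvar : ∀ i x, ∫⁻ s, ‖A.gradF i x s - gradient (f i) x‖ₑ ^ 2 ∂(D i)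
      ≤ ENNReal.ofReal (σ i ^ 2))
    (hG : ∀ t < T, ∀ i,
      ∫⁻ θ, ‖A.gradF i ((SPARQ.run A ξ ζ t θ).x i) (ξ t i θ)‖ₑ ^ 2 ∂P ≤ ENNReal.ofReal (G ^ 2))
    -- compression
    (hω : 0 < ω) (hω1 : ω ≤ 1)
    (hCmeas : Measurable (Function.uncurry A.C))
    (hC : SPARQ.IsCompression ω ν A.C)
    -- mixing matrix and consensus step size
    (hW : SPARQ.IsDoublyStochasticSymm A.W) (hgap : SPARQ.absLambdaTwo A.W < 1)
    (hγ : A.γ = SPARQ.gammaStar A.W ω)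
    -- synchronization indices
    (hI0 : 0 ∈ A.I) (hI : SPARQ.GapLE A.I T H)
    -- thresholds
    (hε : 0 < ε) (hε1 : ε < 1) (hc₀ : 0 ≤ c₀)
    (hcmono : Monotone A.c) (hcnonneg : ∀ t, 0 ≤ A.c t)
    (hc : ∀ t : ℕ, A.c t ≤ c₀ * (t : ℝ) ^ (1 - ε))
    -- learning rate
    (ha : max (32 * L / μ) (5 * H / SPARQ.pRate A.W ω) ≤ a)
    (hη : ∀ t : ℕ, A.η t = 8 / (μ * (a + t))) :
    Integrable (fun θ => SPARQ.globalObj f (SPARQ.xAvg A ξ ζ a T θ)) P ∧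
    ∫ θ, SPARQ.globalObj f (SPARQ.xAvg A ξ ζ a T θ) ∂P - SPARQ.globalObj f xstar
      ≤ μ * a ^ 3 / (8 * SPARQ.weightSum a T) * ‖A.x0 - xstar‖ ^ 2
        + 4 * T * (T + 2 * a) / (μ * SPARQ.weightSum a T) * (((∑ i, σ i ^ 2) / n) / n)
        + 512 * 160 * ((2 * L + μ) * G ^ 2 * H ^ 2 * T
            / (μ ^ 2 * SPARQ.pRate A.W ω ^ 2 * SPARQ.weightSum a T))
        + 6400 / (2 - ε) * (c₀ * ω * (2 * L + μ) * (T : ℝ) ^ (2 - ε)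
            / (μ ^ 2 * SPARQ.pRate A.W ω * SPARQ.weightSum a T)) ∧
    (T : ℝ) ^ 3 / 3 ≤ SPARQ.weightSum a T ∧
    (a ^ 3 ≤ T →
      ∫ θ, SPARQ.globalObj f (SPARQ.xAvg A ξ ζ a T θ) ∂P - SPARQ.globalObj f xstar
        ≤ 36 * (((∑ i, σ i ^ 2) / n) / (μ * n * T))
          + 250000 * ((2 * L + μ) * G ^ 2 * H ^ 2
              / (μ ^ 2 * SPARQ.pRate A.W ω ^ 2 * (T : ℝ) ^ 2))
          + 19200 * (c₀ * ω * (2 * L + μ)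
              / (μ ^ 2 * SPARQ.pRate A.W ω * (T : ℝ) ^ (1 + ε)))) := by
  have hrun : SPARQ.IsRun P D ν f G ω σ T A ξ ζ :=
    ⟨hsamp, hgmeas, hunbiased, hvar, hG, hω, hω1, hCmeas, hC, hcnonneg⟩
  obtain ⟨hp0, hp1⟩ := SPARQ.pRate_pos hn hW hgap hω hω1
  have hn' : (0 : ℝ) < n := by exact_mod_cast hn
  have hL : 0 ≤ L := (hsmooth ⟨0, hn⟩).1
  have haL := (le_max_left _ _).trans ha
  have haH := (le_max_right _ _).trans ha
  -- the first round has positive length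
  have hH : 1 ≤ H := by
    obtain ⟨s, -, hs, hsH, -⟩ := SPARQ.exists_round hI0 hI (by omega : 0 < T)
    omega
  have hHr : (1 : ℝ) ≤ H := by exact_mod_cast hH
  have ha1 : 1 ≤ a := by
    refine le_trans ?_ haH
    rw [le_div_iff₀ hp0]
    linarith
  have ha0 : 0 < a := by linarith
  have hat : ∀ t : ℕ, 0 < a + t := fun t => by positivity
  have hη0 : ∀ t, 0 ≤ A.η t := fun t => by rw [hη]; have := hat t; positivity
  have hηa : Antitone A.η := fun s t hst => by
    rw [hη, hη]
    have := hat s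
    have : (s : ℝ) ≤ t := by exact_mod_cast hst
    gcongr
  have hηL : ∀ t, A.η t * L ≤ 1 / 4 := fun t => by
    rw [div_le_iff₀ hμ] at haL
    have h1 := hat t
    have h2 : 0 ≤ (t : ℝ) * μ := by positivity
    rw [hη, div_mul_eq_mul_div, div_le_iff₀ (by positivity)]
    linarith
  have hS3 := SPARQ.cube_div_three_le_weightSum ha1 T
  have hTr : (1 : ℝ) ≤ T := by exact_mod_cast hT
  have hS0 : 0 < SPARQ.weightSum a T := lt_of_lt_of_le (by positivity) hS3
  have hX : ∀ t ≤ T, MemLp (fun θ => SPARQ.nodeAvg (SPARQ.run A ξ ζ t θ).x) 2 P := fun t ht =>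
    SPARQ.memLp_nodeAvg (hrun.memLp_state ht).1
  have hF : ∀ t ≤ T, Integrable
      (fun θ => SPARQ.globalObj f (SPARQ.nodeAvg (SPARQ.run A ξ ζ t θ).x)) P := fun t ht =>
    SPARQ.integrable_globalObj hn hsmooth hxstar (hX t ht)
  have hlt : ∀ t ∈ Finset.range T, t ≤ T := fun t ht => (Finset.mem_range.1 ht).le
  have hXavg : MemLp (SPARQ.xAvg A ξ ζ a T) 2 P := by
    have h1 : ∀ t ∈ Finset.range T, MemLp
        (fun θ => (a + (t : ℝ)) ^ 2 • SPARQ.nodeAvg (SPARQ.run A ξ ζ t θ).x) 2 P := fun t ht =>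
      (hX t (hlt t ht)).const_smul ((a + (t : ℝ)) ^ 2)
    exact (memLp_finsetSum _ h1).const_smul (SPARQ.weightSum a T)⁻¹
  have hFavg := SPARQ.integrable_globalObj hn hsmooth hxstar hXavg
  set S := SPARQ.weightSum a T with hSdef
  set p := SPARQ.pRate A.W ω with hp
  set V := (∑ i, σ i ^ 2) / n with hV
  have hV0 : 0 ≤ V := by positivity
  -- Jensen's inequality reduces the claim to the weighted sum of the suboptimalities
  have hjensen : ∫ θ, SPARQ.globalObj f (SPARQ.xAvg A ξ ζ a T θ) ∂P - SPARQ.globalObj f xstar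
      ≤ S⁻¹ * ∑ t ∈ Finset.range T, (a + t) ^ 2 *
        (∫ θ, SPARQ.globalObj f (SPARQ.nodeAvg (SPARQ.run A ξ ζ t θ).x) ∂P
          - SPARQ.globalObj f xstar) := by
    have hI : ∀ t ∈ Finset.range T, Integrable (fun θ => (a + (t : ℝ)) ^ 2 *
        SPARQ.globalObj f (SPARQ.nodeAvg (SPARQ.run A ξ ζ t θ).x)) P := fun t ht =>
      (hF t (hlt t ht)).const_mul _
    have h1 : ∫ θ, SPARQ.globalObj f (SPARQ.xAvg A ξ ζ a T θ) ∂P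
        ≤ ∫ θ, S⁻¹ * ∑ t ∈ Finset.range T, (a + t) ^ 2 *
          SPARQ.globalObj f (SPARQ.nodeAvg (SPARQ.run A ξ ζ t θ).x) ∂P :=
      integral_mono hFavg ((integrable_finsetSum _ hI).const_mul _) fun θ =>
        SPARQ.globalObj_weighted_le hn hμ.le hconv (fun t => sq_nonneg (a + (t : ℝ))) hS0
          fun t => SPARQ.nodeAvg (SPARQ.run A ξ ζ t θ).x
    rw [integral_const_mul, integral_finsetSum _ hI] at h1
    simp_rw [integral_const_mul] at h1
    have h2 : ∑ t ∈ Finset.range T, (a + (t : ℝ)) ^ 2 = S := rfl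
    simp_rw [mul_sub, Finset.sum_sub_distrib, ← Finset.sum_mul, h2, mul_sub, ← mul_assoc,
      inv_mul_cancel₀ hS0.ne', one_mul]
    linarith
  have hsum := SPARQ.weighted_sum_le (T := T) (B := V / n) (κ := 2 * L + μ)
    (K₁ := 1280 * (H ^ 2 * G ^ 2 / p ^ 2)) (K₂ := 100 * ω / p) (η := A.η) (c := A.c)
    (u := fun t => ∫ θ, ‖SPARQ.nodeAvg (SPARQ.run A ξ ζ t θ).x - xstar‖ ^ 2 ∂P)
    (e := fun t => ∫ θ, SPARQ.globalObj f (SPARQ.nodeAvg (SPARQ.run A ξ ζ t θ).x) ∂P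
      - SPARQ.globalObj f xstar)
    (r := fun t => (n : ℝ)⁻¹ * ∫ θ, SPARQ.dev (SPARQ.run A ξ ζ t θ).x ∂P)
    hμ ha1 (by positivity) (by positivity) (by positivity) hc₀ hε1 hη
    (fun t => integral_nonneg fun θ => sq_nonneg _) hc
    (fun t ht => hrun.integral_dev_le hn hW hgap hγ hμ ha0 haH hη hη0 hηa hcmono hI0 hI ht)
    (fun t ht => hrun.integral_norm_nodeAvg_succ_le hn hμ hsmooth hconv hxstar hW ht (hη0 t)
      (hηL t) (hF t ht.le))
  have hu0 : ∫ θ, ‖SPARQ.nodeAvg (SPARQ.run A ξ ζ 0 θ).x - xstar‖ ^ 2 ∂P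
      = ‖A.x0 - xstar‖ ^ 2 := by
    simp [SPARQ.run, SPARQ.nodeAvg_const hn]
  have hmain : ∫ θ, SPARQ.globalObj f (SPARQ.xAvg A ξ ζ a T θ) ∂P - SPARQ.globalObj f xstar
      ≤ μ * a ^ 3 / (8 * S) * ‖A.x0 - xstar‖ ^ 2
        + 4 * T * (T + 2 * a) / (μ * S) * (V / n)
        + 512 * 160 * ((2 * L + μ) * G ^ 2 * H ^ 2 * T / (μ ^ 2 * p ^ 2 * S))
        + 6400 / (2 - ε) * (c₀ * ω * (2 * L + μ) * (T : ℝ) ^ (2 - ε) / (μ ^ 2 * p * S)) := by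
    refine hjensen.trans ((mul_le_mul_of_nonneg_left hsum (inv_nonneg.2 hS0.le)).trans
      (le_of_eq ?_))
    simp only [hu0]
    have h2ε : 2 - ε ≠ 0 := by linarith
    field_simp
    ring
  refine ⟨hFavg, hmain, hS3, fun haT => hmain.trans ?_⟩
  exact SPARQ.rate_le_of_cube_le hμ hL hω hc₀ hε hε1 ha1 hp0 (by linarith)
    (hrun.norm_x0_sub_sq_le hn (by omega) hμ hconv hxstar) (sq_nonneg _) hV0 hn' hHr hTr hS3 haT
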